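/- Let $\Omega\subset\mathbb{R}^2$ be a bounded open set (for instance a bounded Gröger-regular domain; no regularity of the boundary and no connectedness is needed). Let $0<q_{\min}<q_{\max}$, $\psi>0$, $\alpha>0$, $\gamma>0$ be real numbers, let $f,u_d\in L^2(\Omega)$, and put $$Q^{\rm ad}=\{q\in L^2(\Omega;\mathbb{R}^{2\times2}_{\rm sym})\;:\; q_{\min}I\preccurlyeq q(x)\preccurlyeq q_{\max}I\ \text{for a.e. }x\in\Omega\},$$ where $\preccurlyeq$ is the positive semidefinite (Loewner) order. Let $A:B=\sum_{i,j}A_{ij}B_{ij}$ be the Frobenius inner product, let $\|\cdot\|$ be the norm of $L^2(\Omega)$, respectively of $L^2(\Omega;\mathbb{R}^{2\times 2})$ with Frobenius norm, and let $$r(\gamma,s)=\gamma\max(s-\psi,0)^3,\qquad s\in\mathbb{R}.$$ Consider the problem $$(P_\gamma)\qquad \min\ J(q,u)=\tfrac12\|u-u_d\|^2+\tfrac{\alpha}{2}\|q\|^2\quad\text{s.t.}\quad q\in Q^{\rm ad},\ u\in H^1_0(\Omega),\ -\nabla\cdot(q\nabla u)+r(\gamma,u)=f\ \text{ in }H^{-1}(\Omega),$$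 where an equation $-\nabla\cdot(q\nabla u)=g$ in $H^{-1}(\Omega)$ means $\int_\Omega (q\nabla u)\cdot\nabla v\,dx=\int_\Omega g\,v\,dx$ for all $v\in H^1_0(\Omega)$, with both integrands integrable. Let $(\bar q_\gamma,\bar u_\gamma)\in Q^{\rm ad}\times H^1_0(\Omega)$ be a local minimizer of $(P_\gamma)$, that is, a feasible pair that minimizes $J$ among all feasible pairs in some neighbourhood of it in $L^2(\Omega;\mathbb{R}^{2\times2})\times H^1_0(\Omega)$. Then there exists $\bar p_\gamma\in H^1_0(\Omega)$ such that $$-\nabla\cdot(\bar q_\gamma\nabla\bar u_\gamma)=f-r(\gamma,\bar u_\gamma)\quad\text{in }H^{-1}(\Omega),$$ $$-\nabla\cdot(\bar q_\gamma\nabla\bar p_\gamma)=\bar u_\gamma-u_d-\partial_u r(\gamma,\bar u_\gamma)\,\bar p_\gamma\quad\text{in }H^{-1}(\Omega),$$ and, for all $q\in Q^{\rm ad}$, the function $(\alpha\bar q_\gamma-\nabla\bar u_\gamma\otimes\nabla\bar p_\gamma):(q-\bar q_\gamma)$ is integrable on $\Omega$ and $$\int_\Omega\bigl(\alpha\bar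 q_\gamma-\nabla\bar u_\gamma\otimes\nabla\bar p_\gamma\bigr):(q-\bar q_\gamma)\,dx\ \ge\ 0,$$ where $a\otimes b=(a_ib_j)_{i,j}$ is the outer product. -/

import Mathlib

open MeasureTheory TopologicalSpace Topology
open scoped Distributions ContDiff Gradient ENNReal Matrix Matrix.Norms.Frobenius

namespace CoefficientControl

/-- Euclidean space `ℝ^d`. -/
abbrev E (d : ℕ) := EuclideanSpace ℝ (Fin d)

/-- `L²(Ω; F)` with respect to Lebesgue measure on the open set `Ω ⊆ ℝ^d`. For matrix-valued
functions the values carry the Frobenius norm. -/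
noncomputable abbrev L2 {d : ℕ} (Ω : Opens (E d)) (F : Type) [NormedAddCommGroup F] :=
  Lp F 2 (volume.restrict (Ω : Set (E d)))

/-- `L²(Ω) × L²(Ω; ℝ^d)` with its Hilbert space norm; the Sobolev space `H¹(Ω)` consists of the
pairs `(u, ∇u)` in it. -/
noncomputable abbrev L2Pair {d : ℕ} (Ω : Opens (E d)) := WithLp 2 (L2 Ω ℝ × L2 Ω (E d))

section Sobolev

variable {d : ℕ} {Ω : Opens (E d)}

/-- `g` is the weak gradient of `u` on `Ω`:
`∫_Ω u ∂_e φ = - ∫_Ω (g · e) φ` for all test functions `φ ∈ C_c^∞(Ω)` and all directions `e`. -/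
def HasWeakGradient (u : L2 Ω ℝ) (g : L2 Ω (E d)) : Prop :=
  ∀ (φ : 𝓓(Ω, ℝ)) (e : E d),
    ∫ x in (Ω : Set (E d)), u x * fderiv ℝ φ x e =
      - ∫ x in (Ω : Set (E d)), inner ℝ (g x) e * φ x

theorem test_memLp (φ : 𝓓(Ω, ℝ)) : MemLp φ 2 (volume.restrict (Ω : Set (E d))) :=
  (φ.continuous.memLp_of_hasCompactSupport φ.hasCompactSupport).restrict _

theorem test_differentiable (φ : 𝓓(Ω, ℝ)) : Differentiable ℝ φ :=
  φ.contDiff.differentiable (by simp)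

theorem test_continuous_fderiv (φ : 𝓓(Ω, ℝ)) : Continuous (fderiv ℝ φ) :=
  φ.contDiff.continuous_fderiv (by simp)

theorem test_continuous_gradient (φ : 𝓓(Ω, ℝ)) : Continuous (∇ (φ : E d → ℝ)) :=
  (InnerProductSpace.toDual ℝ (E d)).symm.continuous.comp (test_continuous_fderiv φ)

theorem test_gradient_compact (φ : 𝓓(Ω, ℝ)) : HasCompactSupport (∇ (φ : E d → ℝ)) :=
  (φ.hasCompactSupport.fderiv (𝕜 := ℝ)).comp_left (g := (InnerProductSpace.toDual ℝ (E d)).symm)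
    (map_zero _)

theorem test_gradient_memLp (φ : 𝓓(Ω, ℝ)) :
    MemLp (∇ (φ : E d → ℝ)) 2 (volume.restrict (Ω : Set (E d))) :=
  ((test_continuous_gradient φ).memLp_of_hasCompactSupport (test_gradient_compact φ)).restrict _

/-- The pair `(φ, ∇φ)` of a test function `φ ∈ C_c^∞(Ω)`. -/
noncomputable def testPair (φ : 𝓓(Ω, ℝ)) : L2Pair Ω :=
  WithLp.toLp 2 ((test_memLp φ).toLp φ, (test_gradient_memLp φ).toLp (∇ (φ : E d → ℝ)))

theorem integral_mul_eq_inner (u : L2 Ω ℝ) (f : E d → ℝ)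
    (hf : MemLp f 2 (volume.restrict (Ω : Set (E d)))) :
    ∫ x in (Ω : Set (E d)), u x * f x = inner ℝ u (hf.toLp f) := by
  rw [L2.inner_def]
  refine integral_congr_ae ?_
  filter_upwards [hf.coeFn_toLp] with x hx
  rw [hx, real_inner_eq_re_inner]
  simp [mul_comm]

theorem test_smul_memLp (φ : 𝓓(Ω, ℝ)) (e : E d) :
    MemLp (fun x => φ x • e) 2 (volume.restrict (Ω : Set (E d))) :=
  ((φ.continuous.smul continuous_const).memLp_of_hasCompactSupport
    (φ.hasCompactSupport.smul_right (f' := fun _ => e))).restrict _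

theorem test_fderiv_memLp (φ : 𝓓(Ω, ℝ)) (e : E d) :
    MemLp (fun x => fderiv ℝ φ x e) 2 (volume.restrict (Ω : Set (E d))) :=
  (((test_continuous_fderiv φ).clm_apply continuous_const).memLp_of_hasCompactSupport
    ((φ.hasCompactSupport.fderiv (𝕜 := ℝ)).comp_left (g := fun L : E d →L[ℝ] ℝ => L e)
      rfl)).restrict _

theorem integral_inner_mul_eq_inner (g : L2 Ω (E d)) (φ : 𝓓(Ω, ℝ)) (e : E d) :
    ∫ x in (Ω : Set (E d)), inner ℝ (g x) e * φ x =
      inner ℝ g ((test_smul_memLp φ e).toLp (fun x => φ x • e)) := by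
  rw [L2.inner_def]
  refine integral_congr_ae ?_
  filter_upwards [(test_smul_memLp φ e).coeFn_toLp] with x hx
  rw [hx, inner_smul_right, mul_comm]

theorem hasWeakGradient_iff (u : L2 Ω ℝ) (g : L2 Ω (E d)) :
    HasWeakGradient u g ↔ ∀ (φ : 𝓓(Ω, ℝ)) (e : E d),
      inner ℝ u ((test_fderiv_memLp φ e).toLp _) =
        - inner ℝ g ((test_smul_memLp φ e).toLp (fun x => φ x • e)) := by
  refine forall₂_congr fun φ e => ?_
  rw [integral_mul_eq_inner u _ (test_fderiv_memLp φ e), integral_inner_mul_eq_inner]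

theorem HasWeakGradient.add {u u' : L2 Ω ℝ} {g g' : L2 Ω (E d)} (h : HasWeakGradient u g)
    (h' : HasWeakGradient u' g') : HasWeakGradient (u + u') (g + g') := by
  rw [hasWeakGradient_iff] at *
  intro φ e
  rw [inner_add_left, inner_add_left, h φ e, h' φ e, neg_add]

theorem HasWeakGradient.smul {u : L2 Ω ℝ} {g : L2 Ω (E d)} (c : ℝ) (h : HasWeakGradient u g) :
    HasWeakGradient (c • u) (c • g) := by
  rw [hasWeakGradient_iff] at *
  intro φ e
  rw [real_inner_smul_left, real_inner_smul_left, h φ e, mul_neg]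

theorem HasWeakGradient.zero : HasWeakGradient (0 : L2 Ω ℝ) (0 : L2 Ω (E d)) := by
  rw [hasWeakGradient_iff]
  intro φ e
  rw [inner_zero_left, inner_zero_left, neg_zero]

variable (Ω) in
/-- The Sobolev space `H¹(Ω)`, as the space of pairs `(u, ∇u)` with `u ∈ L²(Ω)` and weak gradient
`∇u ∈ L²(Ω; ℝ^d)`. -/
noncomputable def H1 : Submodule ℝ (L2Pair Ω) where
  carrier := {w | HasWeakGradient w.fst w.snd}
  zero_mem' := HasWeakGradient.zero
  add_mem' := fun ha hb => HasWeakGradient.add ha hb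
  smul_mem' := fun c _ ha => HasWeakGradient.smul c ha

variable (Ω) in
/-- The Sobolev space `H¹₀(Ω)`: the closure in the norm `(‖u‖² + ‖∇u‖²)^{1/2}` of the space of test
functions `C_c^∞(Ω)` in `H¹(Ω)`. Its elements are the pairs `(u, ∇u)`. -/
noncomputable def H10 : Submodule ℝ (L2Pair Ω) :=
  (Submodule.span ℝ (Set.range (testPair (Ω := Ω)))).topologicalClosure

/-- The function underlying an element of `H¹₀(Ω)`. -/
noncomputable abbrev value (u : H10 Ω) : L2 Ω ℝ := (u : L2Pair Ω).fst

/-- The weak gradient of an element of `H¹₀(Ω)`. -/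
noncomputable abbrev grad (u : H10 Ω) : L2 Ω (E d) := (u : L2Pair Ω).snd

theorem testPair_mem_H1 (φ : 𝓓(Ω, ℝ)) : testPair φ ∈ H1 Ω := by
  intro ψ e
  have h1 : ∫ x in (Ω : Set (E d)), (testPair φ).fst x * fderiv ℝ ψ x e
      = ∫ x in (Ω : Set (E d)), φ x * fderiv ℝ ψ x e := by
    refine integral_congr_ae ?_
    filter_upwards [(test_memLp φ).coeFn_toLp] with x hx
    simp [testPair, hx]
  have h2 : ∫ x in (Ω : Set (E d)), inner ℝ ((testPair φ).snd x) e * ψ x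
      = ∫ x in (Ω : Set (E d)), fderiv ℝ φ x e * ψ x := by
    refine integral_congr_ae ?_
    filter_upwards [(test_gradient_memLp φ).coeFn_toLp] with x hx
    change inner ℝ ((test_gradient_memLp φ).toLp (∇ (φ : E d → ℝ)) x) e * ψ x = _
    rw [hx, inner_gradient_left]
  have hz : ∀ x, x ∉ (Ω : Set (E d)) → ψ x = 0 := fun x hx =>
    image_eq_zero_of_notMem_tsupport fun h => hx (ψ.tsupport_subset h)
  have hz' : ∀ x, x ∉ (Ω : Set (E d)) → φ x = 0 := fun x hx =>
    image_eq_zero_of_notMem_tsupport fun h => hx (φ.tsupport_subset h)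
  rw [h1, h2, setIntegral_eq_integral_of_forall_compl_eq_zero (fun x hx => by simp [hz' x hx]),
    setIntegral_eq_integral_of_forall_compl_eq_zero (fun x hx => by simp [hz x hx])]
  refine integral_mul_fderiv_eq_neg_fderiv_mul_of_integrable ?_ ?_ ?_
    (fun x _ => test_differentiable φ x) (fun x _ => test_differentiable ψ x)
  · exact (((test_continuous_fderiv φ).clm_apply continuous_const).mul
      ψ.continuous).integrable_of_hasCompactSupport ψ.hasCompactSupport.mul_left
  · exact (φ.continuous.mul ((test_continuous_fderiv ψ).clm_apply
      continuous_const)).integrable_of_hasCompactSupport φ.hasCompactSupport.mul_right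
  · exact (φ.continuous.mul ψ.continuous).integrable_of_hasCompactSupport
      φ.hasCompactSupport.mul_right

theorem isClosed_H1 : IsClosed (H1 Ω : Set (L2Pair Ω)) := by
  have : (H1 Ω : Set (L2Pair Ω)) = ⋂ (φ : 𝓓(Ω, ℝ)) (e : E d), {w : L2Pair Ω |
      inner ℝ w.fst ((test_fderiv_memLp φ e).toLp _) =
        - inner ℝ w.snd ((test_smul_memLp φ e).toLp (fun x => φ x • e))} := by
    ext w
    simp only [Set.mem_iInter, Set.mem_ofPred_eq]
    exact hasWeakGradient_iff _ _
  rw [this]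
  refine isClosed_iInter fun φ => isClosed_iInter fun e => isClosed_eq ?_ ?_
  · exact (WithLp.prod_continuous_ofLp 2 _ _).fst.inner continuous_const
  · exact ((WithLp.prod_continuous_ofLp 2 _ _).snd.inner continuous_const).neg

/-- `H¹₀(Ω) ⊆ H¹(Ω)`. -/
theorem H10_le_H1 : H10 Ω ≤ H1 Ω :=
  Submodule.topologicalClosure_minimal _
    (Submodule.span_le.2 (by rintro _ ⟨φ, rfl⟩; exact testPair_mem_H1 φ)) isClosed_H1

theorem hasWeakGradient_grad (u : H10 Ω) : HasWeakGradient (value u) (grad u) :=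
  H10_le_H1 u.2

end Sobolev

section Problem

variable {d : ℕ} {Ω : Opens (E d)}

/-- The set `Q^ad` of admissible coefficients: the `q ∈ L²(Ω; ℝ^{d×d})` for which, for almost every
`x ∈ Ω`, `q x` is symmetric with `qmin I ≼ q x ≼ qmax I`. (`Matrix.PosSemidef` includes
symmetry.) -/
def Qad (Ω : Opens (E d)) (qmin qmax : ℝ) : Set (L2 Ω (Matrix (Fin d) (Fin d) ℝ)) :=
  {q | ∀ᵐ x ∂(volume.restrict (Ω : Set (E d))),
    (q x - qmin • (1 : Matrix (Fin d) (Fin d) ℝ)).PosSemidef ∧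
    (qmax • (1 : Matrix (Fin d) (Fin d) ℝ) - q x).PosSemidef}

/-- The equation `-∇·(q ∇u) = g` in `H^{-1}(Ω)`, the dual of `H¹₀(Ω)`: for all `v ∈ H¹₀(Ω)`,
`∫_Ω (q ∇u) · ∇v = ∫_Ω g v`, both integrals existing. -/
def NegDivEq (q : L2 Ω (Matrix (Fin d) (Fin d) ℝ)) (u : H10 Ω) (g : E d → ℝ) : Prop :=
  ∀ v : H10 Ω,
    IntegrableOn (fun x => (q x *ᵥ (grad u x).ofLp) ⬝ᵥ (grad v x).ofLp) (Ω : Set (E d)) ∧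
    IntegrableOn (fun x => g x * value v x) (Ω : Set (E d)) ∧
    ∫ x in (Ω : Set (E d)), (q x *ᵥ (grad u x).ofLp) ⬝ᵥ (grad v x).ofLp =
      ∫ x in (Ω : Set (E d)), g x * value v x

/-- The penalization `r(γ; s) = γ max(s - ψ, 0)³` with obstacle `ψ`. -/
noncomputable def penalty (ψ γ s : ℝ) : ℝ := γ * max (s - ψ) 0 ^ 3

/-- The derivative `∂_u r(γ; s)` of the penalization in its second argument. -/
noncomputable def penaltyDeriv (ψ γ s : ℝ) : ℝ := deriv (penalty ψ γ) s

/-- The cost functional `J(q, u) = ½ ‖u - u_d‖² + (α/2) ‖q‖²`. -/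
noncomputable def cost (α : ℝ) (ud : L2 Ω ℝ)
    (z : L2 Ω (Matrix (Fin d) (Fin d) ℝ) × H10 Ω) : ℝ :=
  1 / 2 * ‖value z.2 - ud‖ ^ 2 + α / 2 * ‖z.1‖ ^ 2

/-- The feasible set of the regularized problem: the pairs `(q, u)` with `q ∈ Q^ad`, `u ∈ H¹₀(Ω)` and
`-∇·(q ∇u) + r(γ; u) = f` in `H^{-1}(Ω)`. -/
def feasible (qmin qmax ψ γ : ℝ) (f : L2 Ω ℝ) :
    Set (L2 Ω (Matrix (Fin d) (Fin d) ℝ) × H10 Ω) :=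
  {z | z.1 ∈ Qad Ω qmin qmax ∧ NegDivEq z.1 z.2 (fun x => f x - penalty ψ γ (value z.2 x))}

/-- The Frobenius inner product `A : B` of matrices. -/
def frobInner (A B : Matrix (Fin d) (Fin d) ℝ) : ℝ := ∑ i, ∑ j, A i j * B i j

end Problem

end CoefficientControl

/-! A one-sided derivative test along segments of admissible coefficients. For admissible `q` put `h
= q - qbar` and move to `qbar + t h`, which stays in the convex set `Qad` for `0 ≤ t ≤ 1`. The
Loewner bounds make `qbar` and `h` essentially bounded, so the state equation reads `A u + t B u + N
u = ℓ` in the dual of `H10`, with `A`, `B` the forms of `qbar`, `h` and `N` the penalty. Only the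
scalar `t` varies, so no differentiability of the state in `q` with respect to the `L²` norm is
needed.

In the plane `H10` embeds into `L⁴`, and the cubic penalty is strictly differentiable from `L⁴` to
`L^{4/3}`, the dual exponent (`hasStrictFDerivAt_penaltyOp`). Its derivative is a nonnegative
symmetric form because the penalty is nondecreasing. Together with `q ≽ qmin I` and Poincaré's
inequality this makes the linearized operator coercive (`isCoercive_linearization`). Lax–Milgram
then yields the adjoint state `p`, and with the implicit function theorem a branch `u(t)` through
`ubar` whose derivative `z` solves `(A + N') z = -B ubar` (`exists_solution_branch`).

Local minimality forces the right derivative of the cost at `t = 0` to be nonnegative. It equals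
`⟨ubar - ud, z⟩ + α ∫ qbar : h`. Testing the adjoint equation with `z` and using symmetry turns the
first term into `-∫ (h ∇ubar) · ∇p`, which is the asserted inequality. -/

namespace CoefficientControl

/-! ### Sobolev inequalities on `H10` -/

section Sobolev

open scoped NNReal

variable {d : ℕ} {Ω : Opens (E d)}

/-- Test functions form a vector space on which `testPair` is linear, so the span adds nothing.
Elements of `H10` are thus limits of test pairs themselves, and an inequality that is not additive
can be checked on single test functions. -/
theorem exists_testPair_of_mem_span {w : L2Pair Ω}
    (hw : w ∈ Submodule.span ℝ (Set.range (testPair (Ω := Ω)))) : ∃ φ, testPair φ = w := by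
  have hgrad : ∀ (φ : 𝓓(Ω, ℝ)) x, ∇ (φ : E d → ℝ) x
      = (InnerProductSpace.toDual ℝ (E d)).symm (fderiv ℝ φ x) := fun φ x => rfl
  induction hw using Submodule.span_induction with
  | mem x hx => exact hx
  | zero =>
    refine ⟨0, ?_⟩
    have h1 : ((0 : 𝓓(Ω, ℝ)) : E d → ℝ) = 0 := by ext; simp
    have h2 : ∇ ((0 : 𝓓(Ω, ℝ)) : E d → ℝ) = 0 := by
      ext1 x; rw [hgrad, h1]; simp
    refine WithLp.ofLp_injective 2 (Prod.ext ?_ ?_)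
    · exact (MemLp.toLp_congr (test_memLp _) (MemLp.zero (ε := ℝ)) (.of_eq h1)).trans (MemLp.toLp_zero _)
    · exact (MemLp.toLp_congr (test_gradient_memLp _) (MemLp.zero (ε := E d)) (.of_eq h2)).trans (MemLp.toLp_zero _)
  | add x y _ _ hx hy =>
    obtain ⟨φ, rfl⟩ := hx
    obtain ⟨χ, rfl⟩ := hy
    refine ⟨φ + χ, ?_⟩
    have h1 : ((φ + χ : 𝓓(Ω, ℝ)) : E d → ℝ) = φ + χ := by ext; simp
    have h2 : ∇ ((φ + χ : 𝓓(Ω, ℝ)) : E d → ℝ) = ∇ (φ : E d → ℝ) + ∇ (χ : E d → ℝ) := by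
      ext1 x
      rw [Pi.add_apply, hgrad, hgrad, hgrad, h1,
        fderiv_add (test_differentiable φ x) (test_differentiable χ x), map_add]
    refine WithLp.ofLp_injective 2 (Prod.ext ?_ ?_)
    · exact (MemLp.toLp_congr (test_memLp _) ((test_memLp φ).add (test_memLp χ)) (.of_eq h1)).trans
        (MemLp.toLp_add (test_memLp φ) (test_memLp χ))
    · exact (MemLp.toLp_congr (test_gradient_memLp _) ((test_gradient_memLp φ).add (test_gradient_memLp χ))
        (.of_eq h2)).trans (MemLp.toLp_add (test_gradient_memLp φ) (test_gradient_memLp χ))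
  | smul c x _ hx =>
    obtain ⟨φ, rfl⟩ := hx
    refine ⟨c • φ, ?_⟩
    have h1 : ((c • φ : 𝓓(Ω, ℝ)) : E d → ℝ) = c • (φ : E d → ℝ) := by ext; simp
    have h2 : ∇ ((c • φ : 𝓓(Ω, ℝ)) : E d → ℝ) = c • ∇ (φ : E d → ℝ) := by
      ext1 x
      rw [Pi.smul_apply, hgrad, hgrad, h1,
        fderiv_const_smul (test_differentiable φ x), map_smul]
    refine WithLp.ofLp_injective 2 (Prod.ext ?_ ?_)
    · exact (MemLp.toLp_congr (test_memLp _) ((test_memLp φ).const_smul c) (.of_eq h1)).trans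
        (MemLp.toLp_const_smul c (test_memLp φ))
    · exact (MemLp.toLp_congr (test_gradient_memLp _) ((test_gradient_memLp φ).const_smul c)
        (.of_eq h2)).trans (MemLp.toLp_const_smul c (test_gradient_memLp φ))

/-- A Sobolev inequality for test functions on a bounded set extends to `H¹₀(Ω)`. -/
theorem eLpNorm_value_le_of_test {q : ℝ≥0∞} {C : ℝ≥0}
    (h : ∀ φ : 𝓓(Ω, ℝ), eLpNorm φ q (volume.restrict (Ω : Set (E d))) ≤
      C * eLpNorm (∇ (φ : E d → ℝ)) 2 (volume.restrict (Ω : Set (E d)))) (w : H10 Ω) :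
    eLpNorm (value w) q (volume.restrict (Ω : Set (E d))) ≤ C * ‖grad w‖ₑ := by
  have hw : (w : L2Pair Ω) ∈ closure
      (Submodule.span ℝ (Set.range (testPair (Ω := Ω))) : Set (L2Pair Ω)) := w.2
  obtain ⟨y, hy, hlim⟩ := mem_closure_iff_seq_limit.1 hw
  choose φ hφ using fun n => exists_testPair_of_mem_span (hy n)
  have hfst : Filter.Tendsto (fun n => (y n).fst) Filter.atTop (𝓝 (value w)) :=
    ((WithLp.prod_continuous_ofLp 2 _ _).fst.tendsto _).comp hlim
  have hsnd : Filter.Tendsto (fun n => (y n).snd) Filter.atTop (𝓝 (grad w)) :=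
    ((WithLp.prod_continuous_ofLp 2 _ _).snd.tendsto _).comp hlim
  -- Fatou along an almost everywhere convergent subsequence: the `L^q` norm is lower
  -- semicontinuous, so membership of the limit in `L^q` is a conclusion and not an assumption.
  obtain ⟨ns, hns, hae⟩ := (tendstoInMeasure_of_tendsto_Lp hfst).exists_seq_tendsto_ae
  refine (Lp.eLpNorm_lim_le_liminf_eLpNorm
    (fun n => Lp.aestronglyMeasurable _) _ hae).trans ?_
  have hb : ∀ n, eLpNorm ((y (ns n)).fst) q (volume.restrict (Ω : Set (E d)))
      ≤ C * ‖(y (ns n)).snd‖ₑ := by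
    intro n
    rw [← hφ]
    refine (eLpNorm_congr_ae (test_memLp (φ (ns n))).coeFn_toLp).trans_le ((h _).trans_eq ?_)
    congr 1
    exact (Lp.enorm_toLp (hf := test_gradient_memLp (φ (ns n)))).symm
  have hlim' : Filter.Tendsto (fun n => (C : ℝ≥0∞) * ‖(y (ns n)).snd‖ₑ) Filter.atTop
      (𝓝 (C * ‖grad w‖ₑ)) :=
    ENNReal.Tendsto.const_mul ((continuous_enorm.tendsto _).comp
      (hsnd.comp hns.tendsto_atTop)) (Or.inr ENNReal.coe_ne_top)
  exact (Filter.liminf_le_liminf (Filter.Eventually.of_forall hb)).trans_eq hlim'.liminf_eq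

/-- Sobolev inequality for test functions on a bounded open set, with the `L²` norm of the
gradient on the right. -/
theorem exists_eLpNorm_test_le (hΩ : Bornology.IsBounded (Ω : Set (E d))) {p q : ℝ≥0}
    (hp : 1 ≤ p) (hp2 : p ≤ 2) (hpd : p < d) (hpq : (p : ℝ)⁻¹ - (d : ℝ)⁻¹ ≤ (q : ℝ)⁻¹) :
    ∃ C : ℝ≥0, ∀ φ : 𝓓(Ω, ℝ), eLpNorm φ q (volume.restrict (Ω : Set (E d))) ≤
      C * eLpNorm (∇ (φ : E d → ℝ)) 2 (volume.restrict (Ω : Set (E d))) := by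
  have hfin : (volume.restrict (Ω : Set (E d))) Set.univ ≠ ⊤ := by
    rw [Measure.restrict_apply_univ]; exact hΩ.measure_lt_top.ne
  have hp0 : 0 < p := zero_lt_one.trans_le hp
  -- The factor `|Ω|^(1/p - 1/2)` is the Hölder cost of replacing the `L^p` norm of the gradient by
  -- its `L²` norm.
  set s : ℝ≥0∞ := (volume.restrict (Ω : Set (E d))) Set.univ ^
    (1 / (p : ℝ≥0∞).toReal - 1 / (2 : ℝ≥0∞).toReal) with hs
  have hs_ne_top : s ≠ ⊤ := by
    refine ENNReal.rpow_ne_top_of_nonneg ?_ hfin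
    simp only [ENNReal.coe_toReal, ENNReal.toReal_ofNat]
    have : (p : ℝ) ≤ 2 := by exact_mod_cast hp2
    rw [sub_nonneg]
    exact one_div_le_one_div_of_le (by exact_mod_cast hp0) this
  set K := MeasureTheory.eLpNormLESNormFDerivOfLeConst ℝ (volume : Measure (E d)) (Ω : Set (E d)) p q
  refine ⟨K * s.toNNReal, fun φ => ?_⟩
  have hsub : Function.support (fun x => ‖fderiv ℝ φ x‖) ⊆ (Ω : Set (E d)) := by
    intro x hx
    refine φ.tsupport_subset (support_fderiv_subset ℝ fun h => hx ?_)
    simp [h]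
  have h1 := eLpNorm_le_eLpNorm_fderiv_of_le (volume : Measure (E d)) (u := φ) (s := Ω)
    (φ.contDiff.of_le (by simp)) ((subset_tsupport _).trans φ.tsupport_subset) hp
    (by simpa using hpd) (q := q) (by simpa using hpq) hΩ
  have h2 : eLpNorm (fderiv ℝ φ) p (volume : Measure (E d)) ≤
      eLpNorm (fderiv ℝ φ) 2 (volume.restrict (Ω : Set (E d))) * s := by
    rw [← eLpNorm_norm, ← eLpNorm_restrict_eq_of_support_subset hsub, eLpNorm_norm]
    exact eLpNorm_le_eLpNorm_mul_rpow_measure_univ (by exact_mod_cast hp2)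
      (test_continuous_fderiv φ).aestronglyMeasurable
  have h3 : eLpNorm (∇ (φ : E d → ℝ)) 2 (volume.restrict (Ω : Set (E d))) =
      eLpNorm (fderiv ℝ φ) 2 (volume.restrict (Ω : Set (E d))) :=
    eLpNorm_congr_norm_ae (Filter.Eventually.of_forall fun x =>
      (InnerProductSpace.toDual ℝ (E d)).symm.norm_map (fderiv ℝ φ x))
  calc eLpNorm φ q (volume.restrict (Ω : Set (E d))) ≤ eLpNorm φ q volume :=
        eLpNorm_mono_measure _ Measure.restrict_le_self
    _ ≤ K * (eLpNorm (fderiv ℝ φ) 2 (volume.restrict (Ω : Set (E d))) * s) :=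
        h1.trans (by gcongr)
    _ = _ := by
        rw [h3, ENNReal.coe_mul, ENNReal.coe_toNNReal hs_ne_top]; ring

/-- Poincaré's inequality on a bounded open subset of the plane. -/
theorem exists_norm_value_le {Ω : Opens (E 2)} (hΩ : Bornology.IsBounded (Ω : Set (E 2))) :
    ∃ C : ℝ≥0, ∀ w : H10 Ω, ‖value w‖ ≤ C * ‖grad w‖ := by
  -- Critical exponents in the plane: `1/1 - 1/2 = 1/2`.
  obtain ⟨C, hC⟩ := exists_eLpNorm_test_le hΩ (p := 1) (q := 2) le_rfl (by norm_num) (by norm_num)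
    (by norm_num)
  refine ⟨C, fun w => ?_⟩
  have := eLpNorm_value_le_of_test (q := 2) hC w
  rw [← Lp.enorm_def, enorm_eq_nnnorm, enorm_eq_nnnorm] at this
  exact_mod_cast this

instance fact_one_le_four : Fact ((1 : ℝ≥0∞) ≤ 4) := ⟨by norm_num⟩

/-- The embedding `H¹₀(Ω) ⊆ L⁴(Ω)` for a bounded open subset of the plane. -/
theorem exists_embedding_L4 {Ω : Opens (E 2)} (hΩ : Bornology.IsBounded (Ω : Set (E 2))) :
    ∃ T : H10 Ω →L[ℝ] Lp ℝ 4 (volume.restrict (Ω : Set (E 2))),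
      ∀ w, T w =ᵐ[volume.restrict (Ω : Set (E 2))] value w := by
  -- Since `p < 2` is required, the gradient exponent is lowered to `4/3`, for which `3/4 - 1/2 =
  -- 1/4`.
  obtain ⟨C, hC⟩ := exists_eLpNorm_test_le hΩ (p := 4 / 3) (q := 4)
    (by rw [← NNReal.coe_le_coe]; norm_num) (by rw [← NNReal.coe_le_coe]; norm_num)
    (by rw [← NNReal.coe_lt_coe]; norm_num) (by norm_num)
  have hb := eLpNorm_value_le_of_test (q := 4) hC
  have hmem : ∀ w : H10 Ω, MemLp (value w) 4 (volume.restrict (Ω : Set (E 2))) := fun w =>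
    ⟨Lp.aestronglyMeasurable _, (hb w).trans_lt
      (ENNReal.mul_lt_top ENNReal.coe_lt_top enorm_lt_top)⟩
  have hgrad : ∀ w : H10 Ω, ‖grad w‖ ≤ ‖w‖ := fun w => by
    rw [Submodule.coe_norm]
    exact WithLp.norm_snd_le _ _
  have hadd : ∀ u v : H10 Ω, (hmem (u + v)).toLp _ = (hmem u).toLp _ + (hmem v).toLp _ :=
    fun u v => (MemLp.toLp_congr (hmem (u + v)) ((hmem u).add (hmem v))
      (Lp.coeFn_add (value u) (value v))).trans (MemLp.toLp_add _ _)
  have hsmul : ∀ (c : ℝ) (u : H10 Ω), (hmem (c • u)).toLp _ = c • (hmem u).toLp _ :=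
    fun c u => (MemLp.toLp_congr (hmem (c • u)) ((hmem u).const_smul c)
      (Lp.coeFn_smul c (value u))).trans (MemLp.toLp_const_smul _ _)
  refine ⟨LinearMap.mkContinuous
    { toFun := fun w => (hmem w).toLp _
      map_add' := hadd
      map_smul' := hsmul } C fun w => ?_, fun w => (hmem w).coeFn_toLp⟩
  have h1 := hb w
  rw [← Lp.enorm_toLp (hf := hmem w), enorm_eq_nnnorm, enorm_eq_nnnorm] at h1
  have h2 : ‖(hmem w).toLp (value w)‖ ≤ C * ‖grad w‖ := by exact_mod_cast h1
  calc ‖(hmem w).toLp (value w)‖ ≤ C * ‖grad w‖ := h2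
    _ ≤ C * ‖w‖ := mul_le_mul_of_nonneg_left (hgrad w) C.2

end Sobolev

/-! ### Pointwise calculus of the cubic penalty -/

section Penalty

theorem hasDerivAt_max_zero_pow_three (x : ℝ) :
    HasDerivAt (fun y : ℝ => max y 0 ^ 3) (3 * max x 0 ^ 2) x := by
  rcases lt_trichotomy x 0 with hx | rfl | hx
  · rw [max_eq_right hx.le]
    refine ((hasDerivAt_const x (0 : ℝ)).congr_of_eventuallyEq ?_).congr_deriv (by norm_num)
    filter_upwards [eventually_lt_nhds hx] with y hy
    rw [max_eq_right hy.le]; norm_num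
  -- At the kink the function is dominated by `|y|^3`, which is `o(y)`.
  · have h : HasDerivAt (fun y : ℝ => max y 0 ^ 3) 0 0 := by
      rw [hasDerivAt_iff_isLittleO]
      refine Asymptotics.IsBigO.trans_isLittleO (g := fun y : ℝ => y ^ 3) ?_ ?_
      · refine Asymptotics.IsBigO.of_bound 1 (Filter.Eventually.of_forall fun y => ?_)
        simp only [max_self, sub_zero, smul_zero, one_mul, norm_pow, Real.norm_eq_abs]
        simp only [ne_eq, OfNat.ofNat_ne_zero, not_false_eq_true, zero_pow, sub_zero, abs_pow]
        refine pow_le_pow_left₀ (abs_nonneg _) ?_ 3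
        rw [abs_of_nonneg (le_max_right y 0)]
        exact max_le (le_abs_self y) (abs_nonneg y)
      · simpa using Asymptotics.isLittleO_pow_id (𝕜 := ℝ) (n := 3) (by norm_num)
    simpa using h
  · rw [max_eq_left hx.le]
    refine ((hasDerivAt_pow 3 x).congr_of_eventuallyEq ?_).congr_deriv (by norm_num)
    filter_upwards [eventually_gt_nhds hx] with y hy
    rw [max_eq_left hy.le]

theorem hasDerivAt_penalty (ψ γ s : ℝ) :
    HasDerivAt (penalty ψ γ) (3 * γ * max (s - ψ) 0 ^ 2) s := by
  have h := ((hasDerivAt_max_zero_pow_three (s - ψ)).comp s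
    ((hasDerivAt_id s).sub_const ψ)).const_mul γ
  exact h.congr_deriv (by ring)

theorem penaltyDeriv_eq (ψ γ s : ℝ) : penaltyDeriv ψ γ s = 3 * γ * max (s - ψ) 0 ^ 2 :=
  (hasDerivAt_penalty ψ γ s).deriv

theorem penaltyDeriv_nonneg {γ : ℝ} (hγ : 0 ≤ γ) (ψ s : ℝ) : 0 ≤ penaltyDeriv ψ γ s := by
  rw [penaltyDeriv_eq]; positivity

/-- A nonnegative obstacle makes the truncation vanish at `0` and be dominated by `|s|`, so it
preserves every `L^p`. -/
theorem max_sub_zero_le_abs {ψ : ℝ} (hψ : 0 ≤ ψ) (s : ℝ) : max (s - ψ) 0 ≤ |s| :=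
  max_le ((sub_le_self _ hψ).trans (le_abs_self s)) (abs_nonneg s)

/-- Quantitative strict differentiability of the penalization. -/
theorem abs_penalty_sub_sub_le {ψ γ : ℝ} (hψ : 0 ≤ ψ) (hγ : 0 ≤ γ) (a b c : ℝ) :
    |penalty ψ γ a - penalty ψ γ b - penaltyDeriv ψ γ c * (a - b)| ≤
      6 * γ * ((|a - c| + |b - c|) * (|a| + |b| + |c|)) * |a - b| := by
  have hseg : ∀ x ∈ segment ℝ b a, |x - c| ≤ |a - c| + |b - c| ∧ |x| ≤ |a| + |b| := by
    rintro x ⟨t, s, ht, hs, hts, rfl⟩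
    have ht1 : t ≤ 1 := by linarith
    have hs1 : s ≤ 1 := by linarith
    have key : ∀ y z : ℝ, |t * y + s * z| ≤ |z| + |y| := fun y z => by
      refine (abs_add_le _ _).trans ?_
      rw [abs_mul, abs_mul, abs_of_nonneg ht, abs_of_nonneg hs, add_comm]
      exact add_le_add (mul_le_of_le_one_left (abs_nonneg _) hs1)
        (mul_le_of_le_one_left (abs_nonneg _) ht1)
    simp only [smul_eq_mul]
    refine ⟨?_, key b a⟩
    have : t * b + s * a - c = t * (b - c) + s * (a - c) := by linear_combination c * hts
    rw [this]
    exact key _ _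
  -- The mean value inequality is applied to the penalty minus its linear part at `c`. The
  -- derivative of this difference is small when both endpoints are close to `c`.
  have hd : ∀ x ∈ segment ℝ b a, HasDerivWithinAt
      (fun y => penalty ψ γ y - penaltyDeriv ψ γ c * y)
      (penaltyDeriv ψ γ x - penaltyDeriv ψ γ c) (segment ℝ b a) x := fun x _ => by
    rw [penaltyDeriv_eq ψ γ x]
    simpa using! ((hasDerivAt_penalty ψ γ x).sub
      ((hasDerivAt_id x).const_mul (penaltyDeriv ψ γ c))).hasDerivWithinAt
  have hbound : ∀ x ∈ segment ℝ b a, ‖penaltyDeriv ψ γ x - penaltyDeriv ψ γ c‖ ≤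
      6 * γ * ((|a - c| + |b - c|) * (|a| + |b| + |c|)) := fun x hx => by
    obtain ⟨h1, h2⟩ := hseg x hx
    have h3 : |max (x - ψ) 0 - max (c - ψ) 0| ≤ |x - c| := by
      refine (abs_max_sub_max_le_abs _ _ _).trans_eq ?_
      congr 1; ring
    have h4 : |max (x - ψ) 0 + max (c - ψ) 0| ≤ |x| + |c| := by
      rw [abs_of_nonneg (by positivity)]
      exact add_le_add (max_sub_zero_le_abs hψ x) (max_sub_zero_le_abs hψ c)
    rw [penaltyDeriv_eq, penaltyDeriv_eq, Real.norm_eq_abs]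
    -- The difference of squares splits into a factor controlled by the distance to `c` and one
    -- controlled by the sizes. The constant `3γ` suffices; `6γ` is slack.
    have h5 : 3 * γ * max (x - ψ) 0 ^ 2 - 3 * γ * max (c - ψ) 0 ^ 2 = 3 * γ *
        ((max (x - ψ) 0 - max (c - ψ) 0) * (max (x - ψ) 0 + max (c - ψ) 0)) := by ring
    rw [h5, abs_mul, abs_mul (max _ _ - _), abs_of_nonneg (by positivity : 0 ≤ 3 * γ)]
    have h6 : |max (x - ψ) 0 - max (c - ψ) 0| * |max (x - ψ) 0 + max (c - ψ) 0| ≤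
        (|a - c| + |b - c|) * (|a| + |b| + |c|) :=
      mul_le_mul (h3.trans h1) (h4.trans (by linarith)) (abs_nonneg _) (by positivity)
    calc 3 * γ * _ ≤ 3 * γ * ((|a - c| + |b - c|) * (|a| + |b| + |c|)) := by gcongr
      _ ≤ 6 * γ * ((|a - c| + |b - c|) * (|a| + |b| + |c|)) := by gcongr; norm_num
  have h := (convex_segment b a).norm_image_sub_le_of_norm_hasDerivWithin_le hd hbound
    (left_mem_segment ℝ b a) (right_mem_segment ℝ b a)
  simp only [Real.norm_eq_abs] at h
  refine le_of_eq_of_le ?_ h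
  congr 1; ring

end Penalty

/-! ### The penalty as a superposition operator from `L⁴` to `L^{4/3}` -/

section Nemytskii

/-- The three Hölder triples `(4,4,2)`, `(2,4,4/3)` and `(4/3,4,1)` serve the square in the
derivative, the cube in the penalty, and the duality pairing with `L⁴`. -/
instance holderTriple_four_four_two : ENNReal.HolderTriple 4 4 2 where
  inv_add_inv_eq_inv := by
    rw [← ENNReal.toReal_eq_toReal_iff' (by simp) (by simp), ENNReal.toReal_add (by simp) (by simp)]
    norm_num

instance holderTriple_two_four : ENNReal.HolderTriple 2 4 (4 / 3) where
  inv_add_inv_eq_inv := by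
    rw [← ENNReal.toReal_eq_toReal_iff' (by simp) (by simp [ENNReal.div_eq_zero_iff]),
      ENNReal.toReal_add (by simp) (by simp)]
    simp only [ENNReal.toReal_inv, ENNReal.toReal_div, ENNReal.toReal_ofNat]
    norm_num

instance holderTriple_conjugate_four : ENNReal.HolderTriple (4 / 3) 4 1 where
  inv_add_inv_eq_inv := by
    rw [← ENNReal.toReal_eq_toReal_iff' (by simp [ENNReal.div_eq_zero_iff]) (by simp),
      ENNReal.toReal_add (by simp [ENNReal.div_eq_zero_iff]) (by simp)]
    simp only [ENNReal.toReal_inv, ENNReal.toReal_div, ENNReal.toReal_ofNat]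
    norm_num

instance fact_one_le_four_thirds : Fact ((1 : ℝ≥0∞) ≤ 4 / 3) :=
  ⟨by rw [ENNReal.le_div_iff_mul_le (by simp) (by simp)]; norm_num⟩

variable {X : Type*} [MeasurableSpace X] {μ : Measure X}

theorem memLp_max_sub_zero {ψ : ℝ} (hψ : 0 ≤ ψ) {p : ℝ≥0∞} {u : X → ℝ} (hu : MemLp u p μ) :
    MemLp (fun x => max (u x - ψ) 0) p μ := by
  refine hu.mono ((by fun_prop : Continuous fun s : ℝ => max (s - ψ) 0).comp_aestronglyMeasurable
    hu.1) (Filter.Eventually.of_forall fun x => ?_)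
  rw [Real.norm_eq_abs, abs_of_nonneg (le_max_right _ _)]
  exact max_sub_zero_le_abs hψ (u x)

theorem memLp_penaltyDeriv {ψ : ℝ} (hψ : 0 ≤ ψ) (γ : ℝ) {u : X → ℝ} (hu : MemLp u 4 μ) :
    MemLp (fun x => penaltyDeriv ψ γ (u x)) 2 μ := by
  have h := memLp_max_sub_zero hψ hu
  refine ((h.mul' h (r := 2)).const_mul (3 * γ)).ae_eq (Filter.Eventually.of_forall fun x => ?_)
  simp only [penaltyDeriv_eq]; ring

theorem memLp_penalty {ψ : ℝ} (hψ : 0 ≤ ψ) (γ : ℝ) {u : X → ℝ} (hu : MemLp u 4 μ) :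
    MemLp (fun x => penalty ψ γ (u x)) (4 / 3) μ := by
  have h := memLp_max_sub_zero hψ hu
  refine ((h.mul' (h.mul' h (r := 2)) (r := 4 / 3)).const_mul γ).ae_eq
    (Filter.Eventually.of_forall fun x => ?_)
  simp only [penalty]; ring

/-- The superposition operator `u ↦ r(γ; u)` from `L⁴` to `L^{4/3}`. -/
noncomputable def penaltyOp {ψ : ℝ} (hψ : 0 ≤ ψ) (γ : ℝ) (u : Lp ℝ 4 μ) : Lp ℝ (4 / 3) μ :=
  (memLp_penalty hψ γ (Lp.memLp u)).toLp _

/-- The derivative of `penaltyOp` at `u`, multiplication by `∂_u r(γ; u)`. -/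
noncomputable def penaltyOpDeriv {ψ : ℝ} (hψ : 0 ≤ ψ) (γ : ℝ) (u : Lp ℝ 4 μ) :
    Lp ℝ 4 μ →L[ℝ] Lp ℝ (4 / 3) μ :=
  (ContinuousLinearMap.mul ℝ ℝ).holderL μ 2 4 (4 / 3)
    ((memLp_penaltyDeriv hψ γ (Lp.memLp u)).toLp _)

theorem coeFn_penaltyOp {ψ : ℝ} (hψ : 0 ≤ ψ) (γ : ℝ) (u : Lp ℝ 4 μ) :
    penaltyOp hψ γ u =ᵐ[μ] fun x => penalty ψ γ (u x) :=
  (memLp_penalty hψ γ (Lp.memLp u)).coeFn_toLp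

theorem coeFn_penaltyOpDeriv {ψ : ℝ} (hψ : 0 ≤ ψ) (γ : ℝ) (u w : Lp ℝ 4 μ) :
    penaltyOpDeriv hψ γ u w =ᵐ[μ] fun x => penaltyDeriv ψ γ (u x) * w x := by
  refine ((ContinuousLinearMap.mul ℝ ℝ).coeFn_holder (r := 4 / 3)
    ((memLp_penaltyDeriv hψ γ (Lp.memLp u)).toLp _) w).trans ?_
  filter_upwards [(memLp_penaltyDeriv hψ γ (Lp.memLp u)).coeFn_toLp] with x hx
  rw [hx]; rfl

/-- The pointwise estimate is a product of three `L⁴` functions; two applications of Hölder put it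
in `L^{4/3}`. -/
theorem norm_penaltyOp_sub_sub_le {ψ γ : ℝ} (hψ : 0 ≤ ψ) (hγ : 0 ≤ γ) (u v w : Lp ℝ 4 μ) :
    ‖penaltyOp hψ γ u - penaltyOp hψ γ v - penaltyOpDeriv hψ γ w (u - v)‖ ≤
      6 * γ * ((‖u - w‖ + ‖v - w‖) * (‖u‖ + ‖v‖ + ‖w‖)) * ‖u - v‖ := by
  set A : Lp ℝ 4 μ := |u - w| + |v - w| with hA
  set B : Lp ℝ 4 μ := |u| + |v| + |w| with hB
  set M := ContinuousLinearMap.mul ℝ ℝ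
  have hM : ‖M‖ ≤ 1 := ContinuousLinearMap.opNorm_mul_le ℝ ℝ
  set AB : Lp ℝ 2 μ := M.holder 2 A B with hAB
  set P : Lp ℝ (4 / 3) μ := M.holder (4 / 3) AB (u - v) with hP
  have h1 : ‖penaltyOp hψ γ u - penaltyOp hψ γ v - penaltyOpDeriv hψ γ w (u - v)‖ ≤
      6 * γ * ‖P‖ := by
    refine Lp.norm_le_mul_norm_of_ae_le_mul ?_
    filter_upwards [coeFn_penaltyOp hψ γ u, coeFn_penaltyOp hψ γ v,
      coeFn_penaltyOpDeriv hψ γ w (u - v), Lp.coeFn_sub u v, Lp.coeFn_sub u w, Lp.coeFn_sub v w,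
      Lp.coeFn_sub (penaltyOp hψ γ u) (penaltyOp hψ γ v),
      Lp.coeFn_sub (penaltyOp hψ γ u - penaltyOp hψ γ v) (penaltyOpDeriv hψ γ w (u - v)),
      Lp.coeFn_abs (u - w), Lp.coeFn_abs (v - w), Lp.coeFn_abs u, Lp.coeFn_abs v, Lp.coeFn_abs w,
      Lp.coeFn_add |u - w| |v - w|, Lp.coeFn_add (|u| + |v|) |w|, Lp.coeFn_add |u| |v|,
      M.coeFn_holder (r := 2) A B, M.coeFn_holder (r := 4 / 3) AB (u - v)]
      with x e1 e2 e3 e4 e5 e6 e7 e8 e9 e10 e11 e12 e13 e14 e15 e16 e17 e18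
    rw [← hAB] at e17
    rw [← hP] at e18
    rw [← hA] at e14
    rw [← hB] at e15
    rw [e8, Pi.sub_apply, e7, Pi.sub_apply, e1, e2, e3, e18, e17, e14, e15, e4, Pi.add_apply,
      Pi.add_apply, e16, Pi.add_apply, e9, e10, e11, e12, e13, e5, e6]
    simp only [Pi.sub_apply, M, ContinuousLinearMap.mul_apply', Real.norm_eq_abs]
    refine (abs_penalty_sub_sub_le hψ hγ _ _ _).trans_eq ?_
    rw [abs_mul ((_ + _) * (_ + _)), abs_of_nonneg (by positivity : 0 ≤ (|u x - w x| +
      |v x - w x|) * (|u x| + |v x| + |w x|)), mul_assoc]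
  have h2 : ‖P‖ ≤ ‖A‖ * ‖B‖ * ‖u - v‖ := by
    have h3 := M.norm_holder_apply_apply_le (r := 4 / 3) AB (u - v)
    have h4 := M.norm_holder_apply_apply_le (r := 2) A B
    calc ‖P‖ ≤ ‖M‖ * ‖AB‖ * ‖u - v‖ := h3
      _ ≤ 1 * (1 * ‖A‖ * ‖B‖) * ‖u - v‖ := by
        have h7 : ‖M‖ * ‖A‖ * ‖B‖ ≤ 1 * ‖A‖ * ‖B‖ := by gcongr
        have h8 : ‖AB‖ ≤ 1 * ‖A‖ * ‖B‖ := h4.trans h7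
        gcongr
      _ = _ := by ring
  have h5 : ‖A‖ ≤ ‖u - w‖ + ‖v - w‖ :=
    (norm_add_le |u - w| |v - w|).trans_eq (by rw [norm_abs_eq_norm, norm_abs_eq_norm])
  have h6 : ‖B‖ ≤ ‖u‖ + ‖v‖ + ‖w‖ :=
    (norm_add₃_le (a := |u|) (b := |v|) (c := |w|)).trans_eq (by rw [norm_abs_eq_norm, norm_abs_eq_norm, norm_abs_eq_norm])
  calc _ ≤ 6 * γ * ‖P‖ := h1
    _ ≤ 6 * γ * ((‖u - w‖ + ‖v - w‖) * (‖u‖ + ‖v‖ + ‖w‖) * ‖u - v‖) := by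
      gcongr
      exact h2.trans (by gcongr)
    _ = _ := by ring

/-- The factor in front of `‖u - v‖` tends to zero as both arguments tend to `w`. Strictness is what
the implicit function theorem consumes. -/
theorem hasStrictFDerivAt_penaltyOp {ψ γ : ℝ} (hψ : 0 ≤ ψ) (hγ : 0 ≤ γ) (w : Lp ℝ 4 μ) :
    HasStrictFDerivAt (penaltyOp hψ γ) (penaltyOpDeriv hψ γ w) w := by
  refine HasStrictFDerivAt.of_isLittleO ?_
  have hlim : Filter.Tendsto (fun z : Lp ℝ 4 μ × Lp ℝ 4 μ =>
      6 * γ * ((‖z.1 - w‖ + ‖z.2 - w‖) * (‖z.1‖ + ‖z.2‖ + ‖w‖))) (𝓝 (w, w)) (𝓝 0) := by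
    refine (Continuous.tendsto (by fun_prop) _).trans_eq ?_
    simp
  refine Asymptotics.IsLittleO.of_bound fun c hc => ?_
  filter_upwards [hlim.eventually_le_const hc] with z hz
  exact (norm_penaltyOp_sub_sub_le hψ hγ z.1 z.2 w).trans
    (mul_le_mul_of_nonneg_right hz (norm_nonneg _))

end Nemytskii

/-! ### Matrices, the Frobenius product and Loewner bounds -/

section Matrices

variable {d : ℕ}

/-- Matrices as operators on Euclidean space, as a continuous linear map. -/
noncomputable def matrixAction (d : ℕ) : Matrix (Fin d) (Fin d) ℝ →L[ℝ] E d →L[ℝ] E d :=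
  LinearMap.toContinuousLinearMap
    (Matrix.toEuclideanCLM (n := Fin d) (𝕜 := ℝ)).toAlgEquiv.toLinearMap

theorem inner_matrixAction (A : Matrix (Fin d) (Fin d) ℝ) (a b : E d) :
    inner ℝ (matrixAction d A a) b = (A *ᵥ a.ofLp) ⬝ᵥ b.ofLp := by
  have h : (matrixAction d A a).ofLp = A *ᵥ a.ofLp := rfl
  rw [EuclideanSpace.inner_eq_star_dotProduct, h, dotProduct_comm]
  rfl

theorem inner_matrixAction_comm {A : Matrix (Fin d) (Fin d) ℝ} (hA : A.IsSymm) (a b : E d) :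
    inner ℝ (matrixAction d A a) b = inner ℝ (matrixAction d A b) a := by
  rw [inner_matrixAction, inner_matrixAction, dotProduct_comm, Matrix.dotProduct_mulVec,
    ← Matrix.mulVec_transpose, hA.eq]

/-- Without symmetry the left side is `a · A b`; symmetry moves `A` onto `a`. -/
theorem frobInner_vecMulVec {A : Matrix (Fin d) (Fin d) ℝ} (hA : A.IsSymm) (a b : E d) :
    frobInner (Matrix.vecMulVec a.ofLp b.ofLp) A = inner ℝ (matrixAction d A a) b := by
  rw [inner_matrixAction_comm hA, inner_matrixAction]
  simp only [frobInner, Matrix.vecMulVec_apply, dotProduct, Matrix.mulVec, Finset.sum_mul]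
  refine Finset.sum_congr rfl fun i _ => Finset.sum_congr rfl fun j _ => ?_
  ring

theorem frobInner_self (A : Matrix (Fin d) (Fin d) ℝ) : frobInner A A = ‖A‖ ^ 2 := by
  have h : 0 ≤ ∑ i, ∑ j, ‖A i j‖ ^ (2 : ℝ) := by positivity
  rw [Matrix.frobenius_norm_def, ← Real.sqrt_eq_rpow, Real.sq_sqrt h]
  simp [frobInner, sq]

theorem frobInner_add_smul_self (A B : Matrix (Fin d) (Fin d) ℝ) (t : ℝ) :
    frobInner (A + t • B) (A + t • B) =
      frobInner A A + t * (2 * frobInner A B) + t ^ 2 * frobInner B B := by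
  simp only [frobInner, Finset.mul_sum, ← Finset.sum_add_distrib]
  refine Finset.sum_congr rfl fun i _ => Finset.sum_congr rfl fun j _ => ?_
  simp only [Matrix.add_apply, Matrix.smul_apply, smul_eq_mul]
  ring

theorem frobInner_sub_left (A B C : Matrix (Fin d) (Fin d) ℝ) :
    frobInner (A - B) C = frobInner A C - frobInner B C := by
  simp only [frobInner, ← Finset.sum_sub_distrib]
  refine Finset.sum_congr rfl fun i _ => Finset.sum_congr rfl fun j _ => ?_
  simp only [Matrix.sub_apply]
  ring

theorem frobInner_smul_left (c : ℝ) (A B : Matrix (Fin d) (Fin d) ℝ) :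
    frobInner (c • A) B = c * frobInner A B := by
  simp only [frobInner, Finset.mul_sum]
  refine Finset.sum_congr rfl fun i _ => Finset.sum_congr rfl fun j _ => ?_
  simp only [Matrix.smul_apply, smul_eq_mul]
  ring

theorem frobInner_smul_sub_vecMulVec (c : ℝ) (A : Matrix (Fin d) (Fin d) ℝ) (a b : E d)
    {B : Matrix (Fin d) (Fin d) ℝ} (hB : B.IsSymm) :
    frobInner (c • A - Matrix.vecMulVec a.ofLp b.ofLp) B =
      c * frobInner A B - inner ℝ (matrixAction d B a) b := by
  rw [frobInner_sub_left, frobInner_smul_left, frobInner_vecMulVec hB]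

theorem abs_entry_le_of_posSemidef {A : Matrix (Fin d) (Fin d) ℝ} (hA : A.PosSemidef)
    (i j : Fin d) : |A i j| ≤ (A i i + A j j) / 2 := by
  have hsymm : A j i = A i j := by simpa using hA.isHermitian.apply i j
  -- Positivity of the quadratic form on `e_i + c e_j`; the signs `c = 1` and `c = -1` bound the
  -- entry from both sides.
  have key : ∀ c : ℝ, 0 ≤ A i i + c * A i j + c * A j i + c * c * A j j := fun c => by
    have h := hA.dotProduct_mulVec_nonneg (Pi.single i 1 + c • Pi.single j 1)
    simp only [Matrix.mulVec_add, Matrix.mulVec_smul, star_trivial, add_dotProduct, dotProduct_add,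
      smul_dotProduct, dotProduct_smul, Matrix.mulVec_single_one, single_one_dotProduct,
      Matrix.col_apply, smul_eq_mul] at h
    linarith
  have h1 := key 1
  have h2 := key (-1)
  rw [hsymm] at h1 h2
  rw [abs_le]
  constructor <;> linarith

/-- The upper bound controls the diagonal, and positive semidefiniteness controls every entry by the
diagonal. With `d²` entries of size at most `qmax` the Frobenius norm is at most `d * qmax`. -/
theorem norm_le_of_loewner {qmin qmax : ℝ} (h0 : 0 ≤ qmin) {A : Matrix (Fin d) (Fin d) ℝ}
    (h1 : (A - qmin • (1 : Matrix (Fin d) (Fin d) ℝ)).PosSemidef)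
    (h2 : (qmax • (1 : Matrix (Fin d) (Fin d) ℝ) - A).PosSemidef) : ‖A‖ ≤ d * qmax := by
  have hA : A.PosSemidef := by
    have := h1.add ((Matrix.PosSemidef.one (n := Fin d) (R := ℝ)).smul h0)
    rwa [sub_add_cancel] at this
  have hdiag : ∀ i, A i i ≤ qmax := fun i => by
    have := h2.diag_nonneg (i := i)
    simp only [Matrix.sub_apply, Matrix.smul_apply, Matrix.one_apply_eq, smul_eq_mul,
      mul_one] at this
    linarith
  have hent : ∀ i j, |A i j| ≤ qmax := fun i j =>
    (abs_entry_le_of_posSemidef hA i j).trans (by linarith [hdiag i, hdiag j])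
  -- Nonnegativity of `qmax` is read off an entry, so dimension zero is treated apart.
  rcases isEmpty_or_nonempty (Fin d) with hd | ⟨⟨i⟩⟩
  · rw [Subsingleton.elim A 0, norm_zero]
    have : d = 0 := (Fintype.card_fin d).symm.trans (Fintype.card_eq_zero_iff.2 hd)
    simp [this]
  have hq : 0 ≤ qmax := (abs_nonneg _).trans (hent i i)
  refine abs_le_of_sq_le_sq' ?_ (by positivity) |>.2
  rw [← frobInner_self]
  calc frobInner A A ≤ ∑ _i : Fin d, ∑ _j : Fin d, qmax ^ 2 := by
        refine Finset.sum_le_sum fun i _ => Finset.sum_le_sum fun j _ => ?_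
        rw [← sq, ← sq_abs]
        exact pow_le_pow_left₀ (abs_nonneg _) (hent i j) 2
    _ = (d * qmax) ^ 2 := by simp; ring

theorem inner_matrixAction_ge {qmin : ℝ} {A : Matrix (Fin d) (Fin d) ℝ}
    (h : (A - qmin • (1 : Matrix (Fin d) (Fin d) ℝ)).PosSemidef) (a : E d) :
    qmin * ‖a‖ ^ 2 ≤ inner ℝ (matrixAction d A a) a := by
  have := h.dotProduct_mulVec_nonneg a.ofLp
  rw [star_trivial, Matrix.sub_mulVec, dotProduct_sub, Matrix.smul_mulVec, Matrix.one_mulVec,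
    dotProduct_smul, smul_eq_mul] at this
  rw [inner_matrixAction, dotProduct_comm, EuclideanSpace.real_norm_sq_eq]
  have h2 : a.ofLp ⬝ᵥ a.ofLp = ∑ i, a.ofLp i ^ 2 := by simp [dotProduct, sq]
  rw [← h2]
  linarith

end Matrices

/-! ### The elliptic bilinear form -/

section Elliptic

variable {d : ℕ} {Ω : Opens (E d)}

variable (Ω) in
/-- The map `u ↦ u` from `H¹₀(Ω)` to `L²(Ω)`. -/
noncomputable def valueL : H10 Ω →L[ℝ] L2 Ω ℝ :=
  WithLp.fstL 2 ℝ (L2 Ω ℝ) (L2 Ω (E d)) ∘L (H10 Ω).subtypeL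

variable (Ω) in
/-- The weak gradient as a map from `H¹₀(Ω)` to `L²(Ω; ℝ^d)`. -/
noncomputable def gradL : H10 Ω →L[ℝ] L2 Ω (E d) :=
  WithLp.sndL 2 ℝ (L2 Ω ℝ) (L2 Ω (E d)) ∘L (H10 Ω).subtypeL

@[simp] theorem valueL_apply (u : H10 Ω) : valueL Ω u = value u := rfl

@[simp] theorem gradL_apply (u : H10 Ω) : gradL Ω u = grad u := rfl

/-- The form `(u, v) ↦ ∫_Ω (q ∇u) · ∇v` on `H¹₀(Ω)` for an essentially bounded coefficient `q`. -/
noncomputable def ellipticForm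
    (q : Lp (Matrix (Fin d) (Fin d) ℝ) ∞ (volume.restrict (Ω : Set (E d)))) :
    H10 Ω →L[ℝ] H10 Ω →L[ℝ] ℝ :=
  (innerSL ℝ : L2 Ω (E d) →L[ℝ] L2 Ω (E d) →L[ℝ] ℝ).bilinearComp
    ((matrixAction d).holderL (volume.restrict (Ω : Set (E d))) ∞ 2 2 q ∘L gradL Ω) (gradL Ω)

theorem ellipticForm_add_smul
    (q h : Lp (Matrix (Fin d) (Fin d) ℝ) ∞ (volume.restrict (Ω : Set (E d)))) (t : ℝ) :
    ellipticForm (q + t • h) = ellipticForm q + t • ellipticForm h := by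
  ext u v
  simp [ellipticForm]

theorem ellipticForm_aux
    (q : Lp (Matrix (Fin d) (Fin d) ℝ) ∞ (volume.restrict (Ω : Set (E d)))) (u v : H10 Ω) :
    (fun x => inner ℝ ((matrixAction d).holder 2 q (grad u) x) (grad v x))
      =ᵐ[volume.restrict (Ω : Set (E d))]
    fun x => inner ℝ (matrixAction d (q x) (grad u x)) (grad v x) := by
  filter_upwards [(matrixAction d).coeFn_holder (r := 2) q (grad u)] with x hx
  rw [hx]
  rfl

theorem integrable_ellipticForm
    (q : Lp (Matrix (Fin d) (Fin d) ℝ) ∞ (volume.restrict (Ω : Set (E d)))) (u v : H10 Ω) :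
    Integrable (fun x => inner ℝ (matrixAction d (q x) (grad u x)) (grad v x))
      (volume.restrict (Ω : Set (E d))) :=
  (L2.integrable_inner (𝕜 := ℝ) _ _).congr (ellipticForm_aux q u v)

theorem ellipticForm_apply
    (q : Lp (Matrix (Fin d) (Fin d) ℝ) ∞ (volume.restrict (Ω : Set (E d)))) (u v : H10 Ω) :
    ellipticForm q u v =
      ∫ x in (Ω : Set (E d)), inner ℝ (matrixAction d (q x) (grad u x)) (grad v x) := by
  rw [← integral_congr_ae (ellipticForm_aux q u v)]
  rfl

theorem ellipticForm_comm
    {q : Lp (Matrix (Fin d) (Fin d) ℝ) ∞ (volume.restrict (Ω : Set (E d)))}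
    (hq : ∀ᵐ x ∂(volume.restrict (Ω : Set (E d))), (q x).IsSymm) (u v : H10 Ω) :
    ellipticForm q u v = ellipticForm q v u := by
  rw [ellipticForm_apply, ellipticForm_apply]
  refine integral_congr_ae ?_
  filter_upwards [hq] with x hx
  exact inner_matrixAction_comm hx _ _

theorem ellipticForm_ge {qmin : ℝ}
    {q : Lp (Matrix (Fin d) (Fin d) ℝ) ∞ (volume.restrict (Ω : Set (E d)))}
    (hq : ∀ᵐ x ∂(volume.restrict (Ω : Set (E d))),
      (q x - qmin • (1 : Matrix (Fin d) (Fin d) ℝ)).PosSemidef) (u : H10 Ω) :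
    qmin * ‖grad u‖ ^ 2 ≤ ellipticForm q u u := by
  have h1 : ‖grad u‖ ^ 2 = ∫ x in (Ω : Set (E d)), inner ℝ (grad u x) (grad u x) := by
    rw [← real_inner_self_eq_norm_sq, L2.inner_def]
  rw [ellipticForm_apply, h1, ← integral_const_mul]
  refine integral_mono_ae ((L2.integrable_inner (𝕜 := ℝ) _ _).const_mul _)
    (integrable_ellipticForm q u u) ?_
  filter_upwards [hq] with x hx
  simp only [real_inner_self_eq_norm_sq]
  exact inner_matrixAction_ge hx _

end Elliptic

/-! ### Admissible coefficients and the quadratic control cost -/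

section Admissible

variable {d : ℕ} {Ω : Opens (E d)} {qmin qmax : ℝ}

/-- Essential boundedness is what keeps `q ∇u` in `L²` and the elliptic form continuous on `H10`. -/
theorem Qad.memLp_top {q : L2 Ω (Matrix (Fin d) (Fin d) ℝ)} (h0 : 0 ≤ qmin)
    (hq : q ∈ Qad Ω qmin qmax) : MemLp q ∞ (volume.restrict (Ω : Set (E d))) := by
  refine memLp_top_of_bound (Lp.aestronglyMeasurable q) (d * qmax) ?_
  filter_upwards [hq] with x hx
  exact norm_le_of_loewner h0 hx.1 hx.2

theorem isSymm_of_loewner {A : Matrix (Fin d) (Fin d) ℝ}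
    (h1 : (A - qmin • (1 : Matrix (Fin d) (Fin d) ℝ)).PosSemidef) : A.IsSymm := by
  have h := h1.isHermitian
  rw [Matrix.IsHermitian, Matrix.conjTranspose_eq_transpose_of_trivial, Matrix.transpose_sub,
    Matrix.transpose_smul, Matrix.transpose_one] at h
  exact sub_left_injective h

theorem convex_Qad : Convex ℝ (Qad Ω qmin qmax) := by
  intro p hp q hq a b ha hb hab
  change ∀ᵐ x ∂_, _
  filter_upwards [hp, hq, Lp.coeFn_add (a • p) (b • q), Lp.coeFn_smul a p, Lp.coeFn_smul b q]
    with x hpx hqx h1 h2 h3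
  rw [h1, Pi.add_apply, h2, h3, Pi.smul_apply, Pi.smul_apply]
  have e : ∀ c : ℝ, c • (1 : Matrix (Fin d) (Fin d) ℝ) = a • (c • 1) + b • (c • 1) := fun c => by
    rw [← add_smul, hab, one_smul]
  constructor
  · rw [e qmin, add_sub_add_comm, ← smul_sub, ← smul_sub]
    exact (hpx.1.smul ha).add (hqx.1.smul hb)
  · rw [e qmax, add_sub_add_comm, ← smul_sub, ← smul_sub]
    exact (hpx.2.smul ha).add (hqx.2.smul hb)

theorem integrable_frobInner (p q : L2 Ω (Matrix (Fin d) (Fin d) ℝ)) :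
    Integrable (fun x => frobInner (p x) (q x)) (volume.restrict (Ω : Set (E d))) := by
  have hent : ∀ (p : L2 Ω (Matrix (Fin d) (Fin d) ℝ)) (i j : Fin d),
      MemLp (fun x => p x i j) 2 (volume.restrict (Ω : Set (E d))) := fun p i j =>
    (LinearMap.toContinuousLinearMap
      (Matrix.entryLinearMap ℝ ℝ i j)).comp_memLp' (Lp.memLp p)
  exact integrable_finsetSum _ fun i _ => integrable_finsetSum _ fun j _ =>
    (hent p i j).integrable_mul (hent q i j)

theorem norm_sq_eq_integral_frobInner (q : L2 Ω (Matrix (Fin d) (Fin d) ℝ)) :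
    ‖q‖ ^ 2 = ∫ x in (Ω : Set (E d)), frobInner (q x) (q x) := by
  have h0 : 0 ≤ ∫ x in (Ω : Set (E d)), ‖q x‖ ^ (2 : ℝ) :=
    integral_nonneg fun x => by positivity
  rw [Lp.norm_def, (Lp.memLp q).eLpNorm_eq_integral_rpow_norm (by simp) (by simp),
    ENNReal.toReal_ofReal (by positivity), ENNReal.toReal_ofNat, ← one_div,
    ← Real.sqrt_eq_rpow, Real.sq_sqrt h0]
  simp [frobInner_self]

/-- An exact quadratic polynomial in `t`: the derivative of the control cost at `0` is its linear
coefficient. -/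
theorem norm_add_smul_sq (p q : L2 Ω (Matrix (Fin d) (Fin d) ℝ)) (t : ℝ) :
    ‖p + t • q‖ ^ 2 = ‖p‖ ^ 2 + t * (2 * ∫ x in (Ω : Set (E d)), frobInner (p x) (q x))
      + t ^ 2 * ‖q‖ ^ 2 := by
  rw [norm_sq_eq_integral_frobInner, norm_sq_eq_integral_frobInner, norm_sq_eq_integral_frobInner,
    ← integral_const_mul, ← integral_const_mul, ← integral_const_mul, ← integral_add,
    ← integral_add]
  · refine integral_congr_ae ?_
    filter_upwards [Lp.coeFn_add p (t • q), Lp.coeFn_smul t q] with x h1 h2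
    rw [h1, Pi.add_apply, h2, Pi.smul_apply]
    exact frobInner_add_smul_self _ _ _
  · exact (integrable_frobInner p p).add (((integrable_frobInner p q).const_mul 2).const_mul t)
  · exact (integrable_frobInner q q).const_mul _
  · exact integrable_frobInner p p
  · exact ((integrable_frobInner p q).const_mul 2).const_mul t

end Admissible

/-! ### Lax–Milgram and the implicit function theorem -/

section Abstract

variable {V : Type*} [NormedAddCommGroup V] [InnerProductSpace ℝ V] [CompleteSpace V]

/-- Lax–Milgram: a coercive form is an isomorphism onto the dual space. -/
theorem bijective_of_isCoercive {B : V →L[ℝ] V →L[ℝ] ℝ} (hB : IsCoercive B) :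
    Function.Bijective B := by
  refine ⟨(injective_iff_map_eq_zero B).2 fun v hv => ?_, fun ℓ => ?_⟩
  · obtain ⟨C, hC, h⟩ := hB
    have h1 := h v
    rw [hv, _root_.zero_apply] at h1
    by_contra hne
    have : 0 < C * ‖v‖ * ‖v‖ := by
      have := norm_pos_iff.2 hne
      positivity
    linarith
  · refine ⟨hB.continuousLinearEquivOfBilin.symm ((InnerProductSpace.toDual ℝ V).symm ℓ), ?_⟩
    ext w
    rw [← hB.continuousLinearEquivOfBilin_apply, ContinuousLinearEquiv.apply_symm_apply,
      InnerProductSpace.toDual_symm_apply]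

theorem isInvertible_of_isCoercive {B : V →L[ℝ] V →L[ℝ] ℝ} (hB : IsCoercive B) :
    B.IsInvertible :=
  ⟨ContinuousLinearEquiv.ofBijective B (LinearMap.ker_eq_bot.2 (bijective_of_isCoercive hB).1)
    (LinearMap.range_eq_top.2 (bijective_of_isCoercive hB).2), rfl⟩

/-- The equation `A u + t B u + N u = ℓ` has a differentiable branch of solutions through a solution
for `t = 0` at which the linearization is coercive. -/
theorem exists_solution_branch {A B : V →L[ℝ] V →L[ℝ] ℝ} {N : V → V →L[ℝ] ℝ}
    {N' : V →L[ℝ] V →L[ℝ] ℝ} {u₀ : V} {ℓ : V →L[ℝ] ℝ} (hN : HasStrictFDerivAt N N' u₀)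
    (hc : IsCoercive (A + N')) (h₀ : A u₀ + N u₀ = ℓ) :
    ∃ (u : ℝ → V) (z : V), u 0 = u₀ ∧ HasDerivAt u z 0 ∧ (A + N') z = -B u₀ ∧
      ∀ᶠ t in 𝓝 (0 : ℝ), A (u t) + t • B (u t) + N (u t) = ℓ := by
  -- At `t = 0` the term with `B` drops out of the partial derivative in `u`, leaving the coercive
  -- `A + N'`; the partial derivative in `t` is `B u₀`.
  set G : ℝ × V → V →L[ℝ] ℝ := fun p => A p.2 + p.1 • B p.2 + N p.2 with hG
  set G' : ℝ × V →L[ℝ] V →L[ℝ] ℝ := (A + N') ∘L ContinuousLinearMap.snd ℝ ℝ V +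
    (ContinuousLinearMap.fst ℝ ℝ V).smulRight (B u₀)
  have hGd : HasStrictFDerivAt G G' (0, u₀) := by
    have h1 : HasStrictFDerivAt (fun p : ℝ × V => A p.2) (A ∘L ContinuousLinearMap.snd ℝ ℝ V)
        (0, u₀) := (A ∘L ContinuousLinearMap.snd ℝ ℝ V).hasStrictFDerivAt
    have h2 : HasStrictFDerivAt (fun p : ℝ × V => B p.2) (B ∘L ContinuousLinearMap.snd ℝ ℝ V)
        (0, u₀) := (B ∘L ContinuousLinearMap.snd ℝ ℝ V).hasStrictFDerivAt
    have h3 : HasStrictFDerivAt (fun p : ℝ × V => N p.2) (N' ∘L ContinuousLinearMap.snd ℝ ℝ V)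
        (0, u₀) := HasStrictFDerivAt.comp (0, u₀) (g := N) (f := Prod.snd) hN hasStrictFDerivAt_snd
    have h4 : HasStrictFDerivAt (fun p : ℝ × V => p.1) (ContinuousLinearMap.fst ℝ ℝ V)
        ((0 : ℝ), u₀) := hasStrictFDerivAt_fst
    refine ((h1.add (h4.smul h2)).add h3).congr_fderiv ?_
    refine ContinuousLinearMap.ext fun p => ?_
    simp [G']
    abel
  have hinr : G' ∘L ContinuousLinearMap.inr ℝ ℝ V = A + N' := by
    ext v : 1
    simp [G']
  have hinv : (G' ∘L ContinuousLinearMap.inr ℝ ℝ V).IsInvertible := by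
    rw [hinr]; exact isInvertible_of_isCoercive hc
  have hG0 : G (0, u₀) = ℓ := by simp [hG, h₀]
  refine ⟨hGd.implicitFunctionOfProdDomain hinv, _,
    (hGd.eventually_apply_eq_iff_implicitFunctionOfProdDomain hinv).self_of_nhds.mp rfl,
    (hGd.hasStrictFDerivAt_implicitFunctionOfProdDomain hinv).hasFDerivAt.hasDerivAt, ?_, ?_⟩
  -- The derivative of the implicit function is `-(A + N')⁻¹ (B u₀)`, and applying `A + N'` cancels
  -- the inverse.
  · obtain ⟨e, he⟩ := isInvertible_of_isCoercive hc
    rw [hinr, ← he, ContinuousLinearMap.inverse_equiv]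
    simp [G']
  · have := hGd.eventually_apply_implicitFunctionOfProdDomain hinv
    rwa [hG0] at this

end Abstract

/-! ### Weak equations as dual equations, and the derivative of the reduced cost -/

section Optimality

/-- Only right difference quotients enter, since a convex combination is guaranteed to be admissible
only for `t ≥ 0`. -/
theorem nonneg_of_hasDerivAt_of_eventually_le {φ : ℝ → ℝ} {c : ℝ} (h : HasDerivAt φ c 0)
    (hle : ∀ᶠ t in 𝓝[>] (0 : ℝ), φ 0 ≤ φ t) : 0 ≤ c := by
  refine ge_of_tendsto h.tendsto_slope_zero_right ?_
  filter_upwards [hle, self_mem_nhdsWithin] with t ht ht0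
  have : (0 : ℝ) < t := ht0
  rw [zero_add, smul_eq_mul]
  exact mul_nonneg (inv_nonneg.2 this.le) (sub_nonneg.2 ht)

variable {d : ℕ} {Ω : Opens (E d)}

/-- Passes from the integral formulation with an `L²` coefficient to an identity of functionals with
its `L^∞` representative, the integrability clauses being automatic for the latter. -/
theorem negDivEq_iff {q : L2 Ω (Matrix (Fin d) (Fin d) ℝ)}
    {Q : Lp (Matrix (Fin d) (Fin d) ℝ) ∞ (volume.restrict (Ω : Set (E d)))}
    (hQ : Q =ᵐ[volume.restrict (Ω : Set (E d))] q) {u : H10 Ω} {g : E d → ℝ} {ℓ : H10 Ω →L[ℝ] ℝ}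
    (hg : ∀ v : H10 Ω, IntegrableOn (fun x => g x * value v x) (Ω : Set (E d)) ∧
      ∫ x in (Ω : Set (E d)), g x * value v x = ℓ v) :
    NegDivEq q u g ↔ ellipticForm Q u = ℓ := by
  have hae : ∀ v : H10 Ω, (fun x => inner ℝ (matrixAction d (Q x) (grad u x)) (grad v x))
      =ᵐ[volume.restrict (Ω : Set (E d))]
      fun x => (q x *ᵥ (grad u x).ofLp) ⬝ᵥ (grad v x).ofLp := fun v => by
    filter_upwards [hQ] with x hx
    rw [inner_matrixAction, hx]
  have happ : ∀ v : H10 Ω, ellipticForm Q u v =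
      ∫ x in (Ω : Set (E d)), (q x *ᵥ (grad u x).ofLp) ⬝ᵥ (grad v x).ofLp := fun v => by
    rw [ellipticForm_apply, integral_congr_ae (hae v)]
  constructor
  · intro h
    ext v
    rw [happ, (h v).2.2, (hg v).2]
  · intro h v
    refine ⟨(integrable_ellipticForm Q u v).congr (hae v), (hg v).1, ?_⟩
    rw [← happ, (hg v).2, h]

theorem integrable_value_mul (f : L2 Ω ℝ) (v : H10 Ω) :
    IntegrableOn (fun x => f x * value v x) (Ω : Set (E d)) :=
  (Lp.memLp f).integrable_mul (Lp.memLp (value v))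

/-- The functional `v ↦ ∫_Ω f v` on `H¹₀(Ω)` for `f ∈ L²(Ω)`. -/
noncomputable def sourceL (f : L2 Ω ℝ) : H10 Ω →L[ℝ] ℝ :=
  innerSL ℝ f ∘L valueL Ω

theorem sourceL_apply (f : L2 Ω ℝ) (v : H10 Ω) :
    sourceL f v = ∫ x in (Ω : Set (E d)), f x * value v x := by
  change inner ℝ f (value v) = _
  rw [L2.inner_def]
  refine integral_congr_ae (Filter.Eventually.of_forall fun x => ?_)
  simp [mul_comm]

/-- For an embedding `T` of `H¹₀(Ω)` into `L⁴(Ω)`, the functional `v ↦ ∫_Ω g v` on `H¹₀(Ω)` for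
`g ∈ L^{4/3}(Ω)`. -/
noncomputable def pairingL (T : H10 Ω →L[ℝ] Lp ℝ 4 (volume.restrict (Ω : Set (E d)))) :
    Lp ℝ (4 / 3) (volume.restrict (Ω : Set (E d))) →L[ℝ] H10 Ω →L[ℝ] ℝ :=
  ContinuousLinearMap.precomp ℝ T ∘L
    (ContinuousLinearMap.mul ℝ ℝ).lpPairing (volume.restrict (Ω : Set (E d))) (4 / 3) 4

variable {T : H10 Ω →L[ℝ] Lp ℝ 4 (volume.restrict (Ω : Set (E d)))}

theorem integrable_mul_value (hT : ∀ w, T w =ᵐ[volume.restrict (Ω : Set (E d))] value w)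
    {g : E d → ℝ} (hg : MemLp g (4 / 3) (volume.restrict (Ω : Set (E d)))) (v : H10 Ω) :
    IntegrableOn (fun x => g x * value v x) (Ω : Set (E d)) :=
  hg.integrable_mul ((Lp.memLp (T v)).ae_eq (hT v))

theorem pairingL_apply (hT : ∀ w, T w =ᵐ[volume.restrict (Ω : Set (E d))] value w)
    {g : E d → ℝ} {G : Lp ℝ (4 / 3) (volume.restrict (Ω : Set (E d)))}
    (hG : G =ᵐ[volume.restrict (Ω : Set (E d))] g) (v : H10 Ω) :
    pairingL T G v = ∫ x in (Ω : Set (E d)), g x * value v x := by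
  change (ContinuousLinearMap.mul ℝ ℝ).lpPairing (volume.restrict (Ω : Set (E d))) (4 / 3) 4 G
    (T v) = _
  rw [ContinuousLinearMap.lpPairing_eq_integral]
  refine integral_congr_ae ?_
  filter_upwards [hG, hT v] with x h1 h2
  rw [h1, h2]
  rfl

variable {ψ γ : ℝ}

theorem penaltyOp_ae (hT : ∀ w, T w =ᵐ[volume.restrict (Ω : Set (E d))] value w) (hψ : 0 ≤ ψ)
    (γ : ℝ) (u : H10 Ω) : penaltyOp hψ γ (T u) =ᵐ[volume.restrict (Ω : Set (E d))]
      fun x => penalty ψ γ (value u x) := by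
  filter_upwards [coeFn_penaltyOp hψ γ (T u), hT u] with x h1 h2
  rw [h1, h2]

theorem penaltyOpDeriv_ae (hT : ∀ w, T w =ᵐ[volume.restrict (Ω : Set (E d))] value w)
    (hψ : 0 ≤ ψ) (γ : ℝ) (u w : H10 Ω) :
    penaltyOpDeriv hψ γ (T u) (T w) =ᵐ[volume.restrict (Ω : Set (E d))]
      fun x => penaltyDeriv ψ γ (value u x) * value w x := by
  filter_upwards [coeFn_penaltyOpDeriv hψ γ (T u) (T w), hT u, hT w] with x h1 h2 h3
  rw [h1, h2, h3]

/-- The form `(v, w) ↦ ∫_Ω ∂_u r(γ; u) v w` on `H¹₀(Ω)`. -/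
noncomputable def penaltyForm (T : H10 Ω →L[ℝ] Lp ℝ 4 (volume.restrict (Ω : Set (E d))))
    (hψ : 0 ≤ ψ) (γ : ℝ) (u : H10 Ω) : H10 Ω →L[ℝ] H10 Ω →L[ℝ] ℝ :=
  pairingL T ∘L penaltyOpDeriv hψ γ (T u) ∘L T

theorem penaltyForm_apply (hT : ∀ w, T w =ᵐ[volume.restrict (Ω : Set (E d))] value w)
    (hψ : 0 ≤ ψ) (γ : ℝ) (u v w : H10 Ω) : penaltyForm T hψ γ u v w =
      ∫ x in (Ω : Set (E d)), penaltyDeriv ψ γ (value u x) * value v x * value w x :=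
  pairingL_apply hT (penaltyOpDeriv_ae hT hψ γ u v) w

theorem penaltyForm_comm (hT : ∀ w, T w =ᵐ[volume.restrict (Ω : Set (E d))] value w)
    (hψ : 0 ≤ ψ) (γ : ℝ) (u v w : H10 Ω) :
    penaltyForm T hψ γ u v w = penaltyForm T hψ γ u w v := by
  rw [penaltyForm_apply hT, penaltyForm_apply hT]
  refine integral_congr_ae (Filter.Eventually.of_forall fun x => ?_)
  simp only
  ring

theorem penaltyForm_self_nonneg (hT : ∀ w, T w =ᵐ[volume.restrict (Ω : Set (E d))] value w)
    (hψ : 0 ≤ ψ) (hγ : 0 ≤ γ) (u v : H10 Ω) : 0 ≤ penaltyForm T hψ γ u v v := by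
  rw [penaltyForm_apply hT]
  refine integral_nonneg fun x => ?_
  simp only [Pi.zero_apply, mul_assoc]
  exact mul_nonneg (penaltyDeriv_nonneg hγ ψ _) (mul_self_nonneg _)

theorem hasStrictFDerivAt_pairingL_penaltyOp (hψ : 0 ≤ ψ) (hγ : 0 ≤ γ) (u : H10 Ω) :
    HasStrictFDerivAt (fun w => pairingL T (penaltyOp hψ γ (T w))) (penaltyForm T hψ γ u) u :=
  HasStrictFDerivAt.comp u (g := pairingL T) (pairingL T).hasStrictFDerivAt
    ((hasStrictFDerivAt_penaltyOp hψ hγ (T u)).comp u T.hasStrictFDerivAt)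

theorem isCoercive_linearization {qmin : ℝ} (hqmin : 0 < qmin) {C : ℝ}
    (hC : ∀ w : H10 Ω, ‖value w‖ ≤ C * ‖grad w‖)
    (hT : ∀ w, T w =ᵐ[volume.restrict (Ω : Set (E d))] value w) (hψ : 0 ≤ ψ) (hγ : 0 ≤ γ)
    {q : Lp (Matrix (Fin d) (Fin d) ℝ) ∞ (volume.restrict (Ω : Set (E d)))}
    (hq : ∀ᵐ x ∂(volume.restrict (Ω : Set (E d))),
      (q x - qmin • (1 : Matrix (Fin d) (Fin d) ℝ)).PosSemidef) (u : H10 Ω) :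
    IsCoercive (ellipticForm q + penaltyForm T hψ γ u) := by
  -- Poincaré gives `‖w‖² ≤ (C² + 1) ‖grad w‖²`; the penalty part is nonnegative and can be dropped.
  refine ⟨qmin / (C ^ 2 + 1), by positivity, fun w => ?_⟩
  have h1 : ‖w‖ ^ 2 = ‖value w‖ ^ 2 + ‖grad w‖ ^ 2 := WithLp.prod_norm_sq_eq_of_L2 (w : L2Pair Ω)
  have h2 : ‖value w‖ ^ 2 ≤ C ^ 2 * ‖grad w‖ ^ 2 := by
    rw [← mul_pow]
    exact pow_le_pow_left₀ (norm_nonneg _) (hC w) 2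
  have h3 : ‖w‖ ^ 2 / (C ^ 2 + 1) ≤ ‖grad w‖ ^ 2 := by
    rw [div_le_iff₀ (by positivity), h1]
    linarith
  calc qmin / (C ^ 2 + 1) * ‖w‖ * ‖w‖ = qmin * (‖w‖ ^ 2 / (C ^ 2 + 1)) := by ring
    _ ≤ qmin * ‖grad w‖ ^ 2 := by gcongr
    _ ≤ ellipticForm q w w + penaltyForm T hψ γ u w w :=
      (ellipticForm_ge hq w).trans
        (le_add_of_nonneg_right (penaltyForm_self_nonneg hT hψ hγ u w))
    _ = (ellipticForm q + penaltyForm T hψ γ u) w w := rfl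

/-- The state equation as an equation in the dual space of `H¹₀(Ω)`. -/
theorem state_iff (hT : ∀ w, T w =ᵐ[volume.restrict (Ω : Set (E d))] value w) (hψ : 0 ≤ ψ)
    {q : L2 Ω (Matrix (Fin d) (Fin d) ℝ)}
    {Q : Lp (Matrix (Fin d) (Fin d) ℝ) ∞ (volume.restrict (Ω : Set (E d)))}
    (hQ : Q =ᵐ[volume.restrict (Ω : Set (E d))] q) (f : L2 Ω ℝ) (u : H10 Ω) :
    NegDivEq q u (fun x => f x - penalty ψ γ (value u x)) ↔
      ellipticForm Q u + pairingL T (penaltyOp hψ γ (T u)) = sourceL f := by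
  have hmem := (Lp.memLp (penaltyOp hψ γ (T u))).ae_eq (penaltyOp_ae hT hψ γ u)
  refine (negDivEq_iff hQ (ℓ := sourceL f - pairingL T (penaltyOp hψ γ (T u))) fun v => ?_).trans
    eq_sub_iff_add_eq
  have h1 := integrable_value_mul f v
  have h2 := integrable_mul_value hT hmem v
  simp only [sub_mul]
  refine ⟨h1.sub h2, ?_⟩
  rw [integral_sub h1 h2, _root_.sub_apply, sourceL_apply,
    pairingL_apply hT (penaltyOp_ae hT hψ γ u)]

/-- The adjoint equation as an equation in the dual space of `H¹₀(Ω)`. -/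
theorem adjoint_iff (hT : ∀ w, T w =ᵐ[volume.restrict (Ω : Set (E d))] value w) (hψ : 0 ≤ ψ)
    {q : L2 Ω (Matrix (Fin d) (Fin d) ℝ)}
    {Q : Lp (Matrix (Fin d) (Fin d) ℝ) ∞ (volume.restrict (Ω : Set (E d)))}
    (hQ : Q =ᵐ[volume.restrict (Ω : Set (E d))] q) (ud : L2 Ω ℝ) (u p : H10 Ω) :
    NegDivEq q p (fun x => value u x - ud x - penaltyDeriv ψ γ (value u x) * value p x) ↔
      (ellipticForm Q + penaltyForm T hψ γ u) p = sourceL (value u - ud) := by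
  have hmem := (Lp.memLp (penaltyOpDeriv hψ γ (T u) (T p))).ae_eq (penaltyOpDeriv_ae hT hψ γ u p)
  refine (negDivEq_iff hQ (ℓ := sourceL (value u - ud) - penaltyForm T hψ γ u p)
    fun v => ?_).trans eq_sub_iff_add_eq
  have hae : (fun x => (value u - ud : L2 Ω ℝ) x * value v x)
      =ᵐ[volume.restrict (Ω : Set (E d))] fun x => (value u x - ud x) * value v x := by
    filter_upwards [Lp.coeFn_sub (value u) ud] with x hx
    rw [hx, Pi.sub_apply]
  have h1 := (integrable_value_mul (value u - ud) v).congr hae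
  have h2 := integrable_mul_value hT hmem v
  simp only [sub_mul _ (penaltyDeriv _ _ _ * _)]
  refine ⟨h1.sub h2, ?_⟩
  rw [integral_sub h1 h2, _root_.sub_apply, sourceL_apply, penaltyForm_apply hT,
    integral_congr_ae hae]

theorem hasDerivAt_cost {α : ℝ} {ud : L2 Ω ℝ} {u : ℝ → H10 Ω} {u₀ z : H10 Ω}
    (hu : HasDerivAt u z 0) (hu0 : u 0 = u₀) (q h : L2 Ω (Matrix (Fin d) (Fin d) ℝ)) :
    HasDerivAt (fun t : ℝ => cost α ud (q + t • h, u t))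
      (sourceL (value u₀ - ud) z + α * ∫ x in (Ω : Set (E d)), frobInner (q x) (h x)) 0 := by
  subst hu0
  have h1 : HasDerivAt (fun t => value (u t) - ud) (value z) 0 :=
    ((valueL Ω).hasFDerivAt.comp_hasDerivAt 0 hu).sub_const ud
  have h2 : HasDerivAt (fun t : ℝ => ‖q + t • h‖ ^ 2)
      (2 * ∫ x in (Ω : Set (E d)), frobInner (q x) (h x)) 0 := by
    simp only [norm_add_smul_sq]
    have := (((hasDerivAt_id (0 : ℝ)).mul_const
      (2 * ∫ x in (Ω : Set (E d)), frobInner (q x) (h x))).const_add (‖q‖ ^ 2)).add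
      (((hasDerivAt_id (0 : ℝ)).pow 2).mul_const (‖h‖ ^ 2))
    exact this.congr_deriv (by simp)
  refine ((h1.norm_sq.const_mul (1 / 2)).add (h2.const_mul (α / 2))).congr_deriv ?_
  change _ = inner ℝ (value (u 0) - ud) (value z) + _
  ring

/-- The difference of admissible coefficients is symmetric, so its pairing with `∇u ⊗ ∇p` is the
integrand of `ellipticForm H`; boundedness of `H` provides integrability. -/
theorem integral_frobInner_gradient {qmin qmax : ℝ} (α : ℝ)
    {q q' : L2 Ω (Matrix (Fin d) (Fin d) ℝ)}
    (hq : q ∈ Qad Ω qmin qmax) (hq' : q' ∈ Qad Ω qmin qmax)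
    {H : Lp (Matrix (Fin d) (Fin d) ℝ) ∞ (volume.restrict (Ω : Set (E d)))}
    (hH : H =ᵐ[volume.restrict (Ω : Set (E d))]
      (q' - q : L2 Ω (Matrix (Fin d) (Fin d) ℝ))) (u p : H10 Ω) :
    IntegrableOn (fun x => frobInner
        (α • q x - Matrix.vecMulVec (grad u x).ofLp (grad p x).ofLp) (q' x - q x))
        (Ω : Set (E d)) ∧
      ∫ x in (Ω : Set (E d)), frobInner
        (α • q x - Matrix.vecMulVec (grad u x).ofLp (grad p x).ofLp) (q' x - q x) =
      α * (∫ x in (Ω : Set (E d)),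
        frobInner (q x) ((q' - q : L2 Ω (Matrix (Fin d) (Fin d) ℝ)) x)) - ellipticForm H u p := by
  have hae : (fun x => α * frobInner (q x) ((q' - q : L2 Ω (Matrix (Fin d) (Fin d) ℝ)) x) -
      inner ℝ (matrixAction d (H x) (grad u x)) (grad p x))
      =ᵐ[volume.restrict (Ω : Set (E d))] fun x => frobInner
        (α • q x - Matrix.vecMulVec (grad u x).ofLp (grad p x).ofLp) (q' x - q x) := by
    filter_upwards [hq, hq', Lp.coeFn_sub q' q, hH] with x h1 h2 h3 h4
    rw [Pi.sub_apply] at h3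
    have e := frobInner_smul_sub_vecMulVec α (q x) (grad u x) (grad p x)
      ((isSymm_of_loewner h2.1).sub (isSymm_of_loewner h1.1))
    rw [e, ← h3, h4]
  have hint1 := (integrable_frobInner q (q' - q)).const_mul α
  have hint2 := integrable_ellipticForm H u p
  exact ⟨(hint1.sub hint2).congr hae, (integral_congr_ae hae).symm.trans
    ((integral_sub hint1 hint2).trans
      (congrArg₂ (· - ·) (integral_const_mul _ _) (ellipticForm_apply H u p).symm))⟩

/-- Along a convex combination of admissible coefficients, a branch of solutions in the dual space is
feasible. -/
theorem mem_feasible_of_branch {qmin qmax : ℝ}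
    (hT : ∀ w, T w =ᵐ[volume.restrict (Ω : Set (E d))] value w) (hψ : 0 ≤ ψ)
    {q q' : L2 Ω (Matrix (Fin d) (Fin d) ℝ)}
    (hq : q ∈ Qad Ω qmin qmax) (hq' : q' ∈ Qad Ω qmin qmax)
    {Q H : Lp (Matrix (Fin d) (Fin d) ℝ) ∞ (volume.restrict (Ω : Set (E d)))}
    (hQ : Q =ᵐ[volume.restrict (Ω : Set (E d))] q)
    (hH : H =ᵐ[volume.restrict (Ω : Set (E d))]
      (q' - q : L2 Ω (Matrix (Fin d) (Fin d) ℝ))) {f : L2 Ω ℝ} {u : H10 Ω} {t : ℝ}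
    (ht : t ∈ Set.Icc (0 : ℝ) 1) (hu : ellipticForm Q u + t • ellipticForm H u +
      pairingL T (penaltyOp hψ γ (T u)) = sourceL f) :
    (q + t • (q' - q), u) ∈ feasible qmin qmax ψ γ f := by
  refine ⟨convex_Qad.add_smul_sub_mem hq hq' ht, ?_⟩
  have hQt : (Q + t • H : Lp _ ∞ _) =ᵐ[volume.restrict (Ω : Set (E d))]
      (q + t • (q' - q) : L2 Ω (Matrix (Fin d) (Fin d) ℝ)) := by
    filter_upwards [Lp.coeFn_add Q (t • H), Lp.coeFn_smul t H, Lp.coeFn_add q (t • (q' - q)),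
      Lp.coeFn_smul t (q' - q), hQ, hH] with x h1 h2 h3 h4 h5 h6
    rw [h1, h3, Pi.add_apply, Pi.add_apply, h2, h4, Pi.smul_apply, Pi.smul_apply, h5, h6]
  refine (state_iff hT hψ hQt f u).2 ?_
  rw [ellipticForm_add_smul]
  exact hu

end Optimality

end CoefficientControl

/-! ### The optimality system -/

open CoefficientControl in
theorem mainTheorem5
    (Ω : TopologicalSpace.Opens (CoefficientControl.E 2))
    (hΩ : Bornology.IsBounded (Ω : Set (CoefficientControl.E 2)))
    (qmin qmax ψ α γ : ℝ) (hqmin : 0 < qmin) (hq : qmin < qmax) (hψ : 0 < ψ) (hα : 0 < α)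
    (hγ : 0 < γ) (f ud : CoefficientControl.L2 Ω ℝ)
    (qbar : CoefficientControl.L2 Ω (Matrix (Fin 2) (Fin 2) ℝ))
    (ubar : CoefficientControl.H10 Ω)
    (hfeas : (qbar, ubar) ∈ CoefficientControl.feasible qmin qmax ψ γ f)
    (hmin : IsLocalMinOn (CoefficientControl.cost α ud)
      (CoefficientControl.feasible qmin qmax ψ γ f) (qbar, ubar)) :
    ∃ pbar : CoefficientControl.H10 Ω,
      CoefficientControl.NegDivEq qbar ubar
        (fun x => f x - CoefficientControl.penalty ψ γ (CoefficientControl.value ubar x)) ∧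
      CoefficientControl.NegDivEq qbar pbar
        (fun x => CoefficientControl.value ubar x - ud x
          - CoefficientControl.penaltyDeriv ψ γ (CoefficientControl.value ubar x) * CoefficientControl.value pbar x) ∧
      ∀ q ∈ CoefficientControl.Qad Ω qmin qmax,
        MeasureTheory.IntegrableOn (fun x => CoefficientControl.frobInner
          (α • qbar x - Matrix.vecMulVec (CoefficientControl.grad ubar x).ofLp (CoefficientControl.grad pbar x).ofLp)
          (q x - qbar x)) (Ω : Set (CoefficientControl.E 2)) ∧
        0 ≤ ∫ x in (Ω : Set (CoefficientControl.E 2)), CoefficientControl.frobInner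
          (α • qbar x - Matrix.vecMulVec (CoefficientControl.grad ubar x).ofLp (CoefficientControl.grad pbar x).ofLp)
          (q x - qbar x) := by

  obtain ⟨C, hC⟩ := exists_norm_value_le hΩ
  obtain ⟨T, hT⟩ := exists_embedding_L4 hΩ
  have : CompleteSpace (H10 Ω) := (Submodule.isClosed_topologicalClosure _).completeSpace_coe
  obtain ⟨hqbar, hstate⟩ := hfeas
  have hqbar_top := Qad.memLp_top hqmin.le hqbar
  obtain ⟨Q, hQ⟩ : ∃ Q : Lp (Matrix (Fin 2) (Fin 2) ℝ) ∞ (volume.restrict (Ω : Set (E 2))),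
    Q =ᵐ[volume.restrict (Ω : Set (E 2))] qbar := ⟨_, hqbar_top.coeFn_toLp⟩
  have hQge : ∀ᵐ x ∂(volume.restrict (Ω : Set (E 2))),
      (Q x - qmin • (1 : Matrix (Fin 2) (Fin 2) ℝ)).PosSemidef := by
    filter_upwards [hQ, hqbar] with x h1 h2
    exact h1 ▸ h2.1
  have hQsymm : ∀ᵐ x ∂(volume.restrict (Ω : Set (E 2))), (Q x).IsSymm :=
    hQge.mono fun x hx => isSymm_of_loewner hx
  have hcoer := isCoercive_linearization hqmin hC hT hψ.le hγ.le hQge ubar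
  -- The linearized operator is symmetric, hence its own adjoint, and Lax–Milgram solves the adjoint
  -- equation directly.
  obtain ⟨p, hp⟩ := (bijective_of_isCoercive hcoer).2 (sourceL (value ubar - ud))
  refine ⟨p, hstate, (adjoint_iff hT hψ.le hQ ud ubar p).2 hp, fun q hqad => ?_⟩
  have hq_top := Qad.memLp_top hqmin.le hqad
  obtain ⟨H, hH⟩ : ∃ H : Lp (Matrix (Fin 2) (Fin 2) ℝ) ∞ (volume.restrict (Ω : Set (E 2))),
      H =ᵐ[volume.restrict (Ω : Set (E 2))] (q - qbar : L2 Ω (Matrix (Fin 2) (Fin 2) ℝ)) :=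
    ⟨_, ((hq_top.sub hqbar_top).ae_eq (Lp.coeFn_sub q qbar).symm).coeFn_toLp⟩
  obtain ⟨hint, hval⟩ := integral_frobInner_gradient α hqbar hqad hH ubar p
  refine ⟨hint, le_of_le_of_eq ?_ hval.symm⟩
  obtain ⟨u, z, hu0, hu, hz, hsol⟩ := exists_solution_branch (B := ellipticForm H)
    (hasStrictFDerivAt_pairingL_penaltyOp (T := T) hψ.le hγ.le ubar) hcoer
    ((state_iff hT hψ.le hQ f ubar).1 hstate)
  -- The adjoint equation is tested with `z`, the linearized state equation with `p`; symmetry of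
  -- both forms identifies the two.
  have hadj : sourceL (value ubar - ud) z = -ellipticForm H ubar p := by
    calc sourceL (value ubar - ud) z
        = (ellipticForm Q + penaltyForm T hψ.le γ ubar) p z :=
          (DFunLike.congr_fun hp z).symm
      _ = ellipticForm Q p z + penaltyForm T hψ.le γ ubar p z := rfl
      _ = ellipticForm Q z p + penaltyForm T hψ.le γ ubar z p :=
        congrArg₂ (· + ·) (ellipticForm_comm hQsymm p z) (penaltyForm_comm hT hψ.le γ ubar p z)
      _ = -ellipticForm H ubar p := DFunLike.congr_fun hz p
  have hderiv := (hasDerivAt_cost (α := α) (ud := ud) hu hu0 qbar (q - qbar)).congr_deriv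
    (congrArg (· + _) hadj)
  have hfeas_t : ∀ᶠ t in 𝓝[>] (0 : ℝ), (qbar + t • (q - qbar), u t) ∈ feasible qmin qmax ψ γ f := by
    filter_upwards [hsol.filter_mono nhdsWithin_le_nhds, self_mem_nhdsWithin,
      nhdsWithin_le_nhds (eventually_lt_nhds (zero_lt_one' ℝ))] with t ht ht0 ht1
    exact mem_feasible_of_branch hT hψ.le hqbar hqad hQ hH ⟨le_of_lt ht0, le_of_lt ht1⟩ ht
  -- Continuity of the branch in `L² × H10` brings it into the neighbourhood where `qbar, ubar` is
  -- minimal.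
  have hlim : Filter.Tendsto (fun t : ℝ => (qbar + t • (q - qbar), u t)) (𝓝[>] 0)
      (𝓝[feasible qmin qmax ψ γ f] (qbar, ubar)) := by
    refine tendsto_nhdsWithin_iff.2 ⟨Filter.Tendsto.mono_left ?_ nhdsWithin_le_nhds, hfeas_t⟩
    have h1 : Filter.Tendsto (fun t : ℝ => qbar + t • (q - qbar)) (𝓝 0) (𝓝 qbar) := by
      have hc : Continuous fun t : ℝ => qbar + t • (q - qbar) :=
        continuous_const.add (continuous_id.smul continuous_const)
      simpa only [zero_smul, add_zero] using hc.tendsto 0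
    have h2 : Filter.Tendsto u (𝓝 0) (𝓝 ubar) := hu0 ▸ hu.continuousAt.tendsto
    exact h1.prodMk_nhds h2
  have hzero : (qbar + (0 : ℝ) • (q - qbar), u 0) = (qbar, ubar) :=
    congrArg₂ Prod.mk ((congrArg (qbar + ·) (zero_smul ℝ (q - qbar))).trans (add_zero qbar)) hu0
  have hle := nonneg_of_hasDerivAt_of_eventually_le hderiv
    ((hlim.eventually hmin).mono fun t ht => (congrArg (cost α ud) hzero).trans_le ht)
  linarith
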